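/- **Setting.** Let $M$ be a connected smooth manifold of dimension $n\ge 2$ (orientable and oriented), $\pi\colon TM\to M$, and $A\subseteq TM$ an open set with $\pi(A)=M$ that is conic ($\lambda v\in A$ for $v\in A$, $\lambda>0$). An $A$-anisotropic tensor field assigns smoothly to each $v\in A$ a tensor on $T_{\pi(v)}M$; $\mathcal T^r_s(M_A)$ denotes those of type $(r,s)$, and $\mathfrak X(M_A)=\mathcal T^1_0(M_A)$. Let $L\colon A\to\mathbb R$ be a pseudo-Finsler metric: smooth, positively $2$-homogeneous, with non-degenerate fundamental tensor $g_v=\tfrac12\,\mathrm{Hess}(L|_{A\cap T_{\pi(v)}M})_v$. In the coordinates $(x,y)$ of $TM$ induced by a chart, let $\gamma^i_{jk}=\tfrac12 g^{ic}(\partial_{x^k}g_{cj}+\partial_{x^j}g_{ck}-\partial_{x^c}g_{jk})$ and $C_{ijk}=\tfrac12\partial_{y^k}g_{ij}$. The metric nonlinear connection $\mathrm HA$ has coefficients $N^i_j=\gamma^i_{jk}y^k-C^i_{jk}\gamma^k_{ab}y^ay^b$; put $\delta_i=\partial_{x^i}-N_i^j\partial_{y^j}$. The Chern anisotropic connection $\nabla$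 has Christoffel symbols $\Gamma^i_{jk}=\tfrac12 g^{il}(\delta_k g_{lj}+\delta_j g_{lk}-\delta_l g_{jk})$; its underlying nonlinear connection has coefficients $\Gamma^i_{jk}y^k$, and the covariant derivative of an anisotropic tensor is $\nabla_kT^{i\dots}_{j\dots}=\delta_kT^{i\dots}_{j\dots}+\Gamma^{i}_{kl}T^{l\dots}_{j\dots}+\dots-\Gamma^l_{kj}T^{i\dots}_{l\dots}-\dots$, with the $\delta_k$ of that underlying connection. For $Z\in\mathfrak X(M_A)$, the anisotropic Lie bracket with respect to $\mathrm HA$ acts on covariant tensors by $$(\mathfrak l^{\mathrm H}_ZS)_{j_1\dots j_s}=Z^k\delta_kS_{j_1\dots j_s}+\sum_{\nu=1}^s(\delta_{j_\nu}Z^k)\,S_{j_1\dots k\dots j_s},$$ with $k$ in the $\nu$-th place. With $d\mathrm{Vol}=\sqrt{|\det g_{ab}|}\,dx^1\wedge\dots\wedge dx^n$, the divergence of $Z$ is the function on $A$ defined by $\mathfrak l^{\mathrm H}_Z(d\mathrm{Vol})=\mathrm{div}(Z)\,d\mathrm{Vol}$. For $T\in\mathcal T^1_1(M_A)$, seen as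 an endomorphism, $T^\flat(X,Y)=g(X,T(Y))$, and $T(\nabla X)$ is the endomorphism field $u\mapsto T(\nabla_uX)$. **Proposition.** Let $S\in\mathcal T^0_2(M_A)$ (a $2$-covariant anisotropic tensor) be symmetric, $v\in A$, $T\in\mathcal T^1_1(M_A)$ and $X\in\mathfrak X(M_A)$. (A) The following are equivalent: - (Ai) $S_v(-,\nabla^v_-X)$ is antisymmetric, i.e. $S_v(a,\nabla^v_bX)=-S_v(b,\nabla^v_aX)$ for all $a,b\in T_{\pi(v)}M$. - (Aii) $\nabla^vX$ is anti-self-adjoint with respect to $S_v$: $S_v(\nabla^v_aX,b)=-S_v(a,\nabla^v_bX)$ for all $a,b$. - (Aiii) $(\mathfrak l^{\mathrm H}_XS)_v=\nabla^v_XS$. (B) On $A$, $$\mathrm{div}(T(X))-\mathrm{trace}(T(\nabla X))=\mathbf C^1_2(\nabla T)(X),$$ where $\mathbf C^1_2$ contracts the contravariant index with the covariant one introduced by $\nabla$, i.e. $\mathbf C^1_2(\nabla T)_j=\nabla_iT^i_j$. (C) One has $\mathrm{trace}(T(\nabla X))(v)=0$ under either of the following conditions: - (Ci) $T^\flat_v(-,\nabla^v_-X)$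 is antisymmetric. - (Cii) $T^\flat_v$ is symmetric and $(\mathfrak l^{\mathrm H}_Xg)_v=0$. -/

import Mathlib

open scoped Manifold ContDiff Topology

noncomputable section

namespace AnisotropicTensors

/-- The model space `ℝⁿ` of the manifold. -/
abbrev Coord (n : ℕ) : Type := EuclideanSpace ℝ (Fin n)

section Fields

variable (n : ℕ) (M : Type*) [TopologicalSpace M] [ChartedSpace (Coord n) M]

/-- The tangent bundle `TM`; `v : TM n M` has base point `v.proj` and vector part `v.2`. -/
abbrev TM := TangentBundle 𝓘(ℝ, Coord n) M

variable {M} in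
/-- The tangent space `T_pM`. -/
abbrev Tan (p : M) := TangentSpace 𝓘(ℝ, Coord n) p

/-- Anisotropic vector fields `X`: `X_v ∈ T_{π(v)}M`. Fields are total functions of `v ∈ TM`; only
their values on the domain `A` matter. -/
abbrev VectorFieldA := (v : TM n M) → Tan n v.proj

/-- Anisotropic tensor fields of type `(1,1)`, seen as endomorphisms. -/
abbrev EndFieldA := (v : TM n M) → (Tan n v.proj →L[ℝ] Tan n v.proj)

/-- Anisotropic `s`-covariant tensor fields. -/
abbrev CovFieldA (s : ℕ) :=
  (v : TM n M) → ContinuousMultilinearMap ℝ (fun _ : Fin s => Tan n v.proj) ℝ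

end Fields

section PseudoFinsler

variable {n : ℕ} {M : Type*} [TopologicalSpace M] [ChartedSpace (Coord n) M]

/-- Half of the vertical Hessian of `L : TM → ℝ`, i.e. half of the second derivative at `v` of the
restriction of `L` to the vector space `T_{π(v)}M`. -/
def halfVerticalHessian (L : TM n M → ℝ) : CovFieldA n M 2 := fun v =>
  (1 / 2 : ℝ) • iteratedFDeriv ℝ 2 (fun y : Coord n => L ⟨v.proj, y⟩) v.2

end PseudoFinsler

/-- A pseudo-Finsler metric `L` on a conic open domain `A ⊆ TM` with `π(A) = M`. The value of `L`
outside `A` is irrelevant. -/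
structure PseudoFinslerMetric (n : ℕ) (M : Type*) [TopologicalSpace M]
    [ChartedSpace (Coord n) M] [IsManifold 𝓘(ℝ, Coord n) ∞ M] where
  /-- the domain `A` -/
  A : Set (TM n M)
  isOpen_A : IsOpen A
  proj_A : ∀ p : M, ∃ v ∈ A, v.proj = p
  conic_A : ∀ v ∈ A, ∀ c : ℝ, 0 < c → (⟨v.proj, c • v.2⟩ : TM n M) ∈ A
  /-- the metric `L` -/
  L : TM n M → ℝ
  smooth_L : ContMDiffOn 𝓘(ℝ, Coord n).tangent 𝓘(ℝ, ℝ) ∞ L A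
  homogeneous_L : ∀ v ∈ A, ∀ c : ℝ, 0 < c → L ⟨v.proj, c • v.2⟩ = c ^ 2 * L v
  nondegenerate : ∀ v ∈ A, ∀ u : Tan n v.proj,
    (∀ w : Tan n v.proj, halfVerticalHessian L v ![u, w] = 0) → u = 0

section Coordinates

variable {n : ℕ} {M : Type*} [TopologicalSpace M] [ChartedSpace (Coord n) M]

/-! The operators on anisotropic tensors are given by their coordinate expressions in a chart `φ`
of the maximal atlas; their values at `v` are tensors on `T_{π(v)}M`. -/

variable (φ : OpenPartialHomeomorph M (Coord n))

/-- The tangent vector with coordinates `(x, y)` in the chart of `TM` induced by `φ`. -/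
def ofCoord (x y : Coord n) : TM n M :=
  ⟨φ.symm x, mfderiv 𝓘(ℝ, Coord n) 𝓘(ℝ, Coord n) φ.symm x y⟩

/-- The coordinate covectors `dxⁱ` at `p`. -/
def dx (p : M) (i : Fin n) : Tan n p →L[ℝ] ℝ :=
  (EuclideanSpace.proj i : Coord n →L[ℝ] ℝ).comp (mfderiv 𝓘(ℝ, Coord n) 𝓘(ℝ, Coord n) φ p)

/-- The coordinate vectors `∂ᵢ` at `p`. -/
def frame (p : M) (i : Fin n) : Tan n p :=
  (mfderiv 𝓘(ℝ, Coord n) 𝓘(ℝ, Coord n) φ.symm (φ p) (EuclideanSpace.single i (1 : ℝ)) : Coord n)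

/-- The coordinates `y = (y¹, …, yⁿ)` of `v`. -/
def fiberCoord (v : TM n M) : Coord n := mfderiv 𝓘(ℝ, Coord n) 𝓘(ℝ, Coord n) φ v.proj v.2

/-- `∂f/∂xᵏ` for a function `f` on `TM`. -/
def partialX (k : Fin n) (f : TM n M → ℝ) (v : TM n M) : ℝ :=
  fderiv ℝ (fun x : Coord n => f (ofCoord φ x (fiberCoord φ v))) (φ v.proj)
    (EuclideanSpace.single k 1)

/-- `∂f/∂yᵏ` for a function `f` on `TM`. -/
def partialY (k : Fin n) (f : TM n M → ℝ) (v : TM n M) : ℝ :=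
  fderiv ℝ (fun y : Coord n => f (ofCoord φ (φ v.proj) y)) (fiberCoord φ v)
    (EuclideanSpace.single k 1)

/-- Components `Xⁱ`. -/
def compVec (X : VectorFieldA n M) (i : Fin n) (v : TM n M) : ℝ := dx φ v.proj i (X v)

/-- Components `Tⁱⱼ`. -/
def compEnd (T : EndFieldA n M) (i j : Fin n) (v : TM n M) : ℝ :=
  dx φ v.proj i (T v (frame φ v.proj j))

/-- Components `S_{j₁ … jₛ}`. -/
def compCov {s : ℕ} (S : CovFieldA n M s) (J : Fin s → Fin n) (v : TM n M) : ℝ :=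
  S v (fun a => frame φ v.proj (J a))

/-- `dx^{j₁} ⊗ … ⊗ dx^{jₛ}` at `p`. -/
def dxTensor {s : ℕ} (p : M) (J : Fin s → Fin n) :
    ContinuousMultilinearMap ℝ (fun _ : Fin s => Tan n p) ℝ :=
  (ContinuousMultilinearMap.mkPiAlgebra ℝ (Fin s) ℝ).compContinuousLinearMap
    (fun a => dx φ p (J a))

/-- `δₖ f = ∂f/∂xᵏ - Nₖʲ ∂f/∂yʲ` for the nonlinear connection with coefficients
`N j k = Nʲₖ`. -/
def delta (N : Fin n → Fin n → TM n M → ℝ) (k : Fin n) (f : TM n M → ℝ) (v : TM n M) : ℝ :=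
  partialX φ k f v - ∑ j, N j k v * partialY φ j f v

section Derivations

/-! ### The covariant derivative of an anisotropic connection

The connection is given by its Christoffel symbols `Γ i j k = Γⁱⱼₖ` in the chart `φ`, where
`∇_{∂ⱼ} ∂ₖ = Γⁱⱼₖ ∂ᵢ`. -/

variable (Γ : Fin n → Fin n → Fin n → TM n M → ℝ)

/-- The coefficients `Nⁱⱼ = Γⁱⱼₖ yᵏ` of the underlying nonlinear connection. -/
def underlying (i j : Fin n) (v : TM n M) : ℝ := ∑ k, Γ i j k v * fiberCoord φ v k

/-- `∇X`, as the endomorphism field `u ↦ ∇_u X`. -/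
def nablaVec (X : VectorFieldA n M) : EndFieldA n M := fun v =>
  ∑ k, ∑ i,
    (delta φ (underlying φ Γ) k (compVec φ X i) v + ∑ l, Γ i k l v * compVec φ X l v) •
      (dx φ v.proj k).smulRight (frame φ v.proj i)

/-- `∇T` for `T` of type `(1,1)`; `nablaEnd φ Γ T v u w = (∇ᵛ_u T)(w)`. -/
def nablaEnd (T : EndFieldA n M) (v : TM n M) :
    Tan n v.proj →L[ℝ] Tan n v.proj →L[ℝ] Tan n v.proj :=
  ∑ k, ∑ i, ∑ j,
    (delta φ (underlying φ Γ) k (compEnd φ T i j) v + ∑ l, Γ i k l v * compEnd φ T l j v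
        - ∑ l, Γ l k j v * compEnd φ T i l v) •
      (dx φ v.proj k).smulRight ((dx φ v.proj j).smulRight (frame φ v.proj i))

/-- `∇_X S` for `S` covariant. -/
def nablaCov {s : ℕ} (X : VectorFieldA n M) (S : CovFieldA n M s) : CovFieldA n M s := fun v =>
  ∑ J : Fin s → Fin n,
    (∑ k, compVec φ X k v *
      (delta φ (underlying φ Γ) k (compCov φ S J) v
        - ∑ a, ∑ l, Γ l k (J a) v * compCov φ S (Function.update J a l) v)) •
      dxTensor φ v.proj J

/-- The anisotropic Lie bracket `𝔩ᴴ_Z S` for `S` covariant, with respect to the nonlinear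
connection with coefficients `N j k = Nʲₖ`. -/
def lieCov (N : Fin n → Fin n → TM n M → ℝ) {s : ℕ} (Z : VectorFieldA n M)
    (S : CovFieldA n M s) : CovFieldA n M s := fun v =>
  ∑ J : Fin s → Fin n,
    ((∑ k, compVec φ Z k v * delta φ N k (compCov φ S J) v)
        + ∑ a, ∑ k, delta φ N (J a) (compVec φ Z k) v *
            compCov φ S (Function.update J a k) v) •
      dxTensor φ v.proj J

end Derivations

/-- `C¹₂`: contraction of the contravariant index of a `(1,2)`-tensor with its derivative index,
`R u w` being the value at the direction `u` of derivation and at the other argument `w`. -/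
def contractDir {p : M} (R : Tan n p →L[ℝ] Tan n p →L[ℝ] Tan n p) (w : Tan n p) : ℝ :=
  LinearMap.trace ℝ (Tan n p)
    { toFun := fun u => R u w
      map_add' := by simp
      map_smul' := by simp }

end Coordinates

/-- Smoothness on `A` of an anisotropic vector field: smooth components in every chart. -/
def SmoothVec {n : ℕ} {M : Type*} [TopologicalSpace M] [ChartedSpace (Coord n) M]
    [IsManifold 𝓘(ℝ, Coord n) ∞ M] (A : Set (TM n M)) (X : VectorFieldA n M) : Prop :=
  ∀ φ ∈ IsManifold.maximalAtlas 𝓘(ℝ, Coord n) ∞ M, ∀ i,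
    ContMDiffOn 𝓘(ℝ, Coord n).tangent 𝓘(ℝ, ℝ) ∞ (compVec φ X i)
      (A ∩ {v | v.proj ∈ φ.source})

/-- Smoothness on `A` of an anisotropic `(1,1)`-tensor field. -/
def SmoothEnd {n : ℕ} {M : Type*} [TopologicalSpace M] [ChartedSpace (Coord n) M]
    [IsManifold 𝓘(ℝ, Coord n) ∞ M] (A : Set (TM n M)) (T : EndFieldA n M) : Prop :=
  ∀ φ ∈ IsManifold.maximalAtlas 𝓘(ℝ, Coord n) ∞ M, ∀ i j,
    ContMDiffOn 𝓘(ℝ, Coord n).tangent 𝓘(ℝ, ℝ) ∞ (compEnd φ T i j)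
      (A ∩ {v | v.proj ∈ φ.source})

/-- Smoothness on `A` of an anisotropic covariant tensor field. -/
def SmoothCov {n : ℕ} {M : Type*} [TopologicalSpace M] [ChartedSpace (Coord n) M]
    [IsManifold 𝓘(ℝ, Coord n) ∞ M] {s : ℕ} (A : Set (TM n M)) (S : CovFieldA n M s) : Prop :=
  ∀ φ ∈ IsManifold.maximalAtlas 𝓘(ℝ, Coord n) ∞ M, ∀ J,
    ContMDiffOn 𝓘(ℝ, Coord n).tangent 𝓘(ℝ, ℝ) ∞ (compCov φ S J)
      (A ∩ {v | v.proj ∈ φ.source})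

namespace PseudoFinslerMetric

variable {n : ℕ} {M : Type*} [TopologicalSpace M] [ChartedSpace (Coord n) M]
  [IsManifold 𝓘(ℝ, Coord n) ∞ M] (F : PseudoFinslerMetric n M)

/-- The fundamental tensor `g`. -/
def g : CovFieldA n M 2 := halfVerticalHessian F.L

/-- `T^♭(a, b) = g(a, T(b))` at `v`. -/
def flat (T : EndFieldA n M) (v : TM n M) (a b : Tan n v.proj) : ℝ := F.g v ![a, T v b]

variable (φ : OpenPartialHomeomorph M (Coord n))

/-- The components `gᵢⱼ`. -/
def gComp (i j : Fin n) (v : TM n M) : ℝ := compCov φ F.g ![i, j] v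

/-- The matrix `(gᵢⱼ(v))`. -/
def gMatrix (v : TM n M) : Matrix (Fin n) (Fin n) ℝ := Matrix.of fun i j => F.gComp φ i j v

/-- The inverse matrix entries `gⁱʲ`. -/
def gInv (i j : Fin n) (v : TM n M) : ℝ := (F.gMatrix φ v)⁻¹ i j

/-- The Cartan tensor `C_{ijk} = ½ ∂g_{ij}/∂yᵏ`. -/
def cartan (i j k : Fin n) (v : TM n M) : ℝ := 1 / 2 * partialY φ k (F.gComp φ i j) v

/-- The formal Christoffel symbols `γⁱⱼₖ` of `g`. -/
def formalChristoffel (i j k : Fin n) (v : TM n M) : ℝ :=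
  1 / 2 * ∑ c, F.gInv φ i c v *
    (partialX φ k (F.gComp φ c j) v + partialX φ j (F.gComp φ c k) v
      - partialX φ c (F.gComp φ j k) v)

/-- The coefficients `Nⁱⱼ = γⁱⱼₖ yᵏ - Cⁱⱼₖ γᵏ_{ab} yᵃ yᵇ` of the metric nonlinear connection,
with `Cⁱⱼₖ = gⁱˡ C_{ljk}`. -/
def metricN (i j : Fin n) (v : TM n M) : ℝ :=
  (∑ k, F.formalChristoffel φ i j k v * fiberCoord φ v k)
    - ∑ k, (∑ l, F.gInv φ i l v * F.cartan φ l j k v) *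
        ∑ a, ∑ b, F.formalChristoffel φ k a b v * fiberCoord φ v a * fiberCoord φ v b

/-- The Christoffel symbols `Γⁱⱼₖ` of the Chern anisotropic connection. -/
def chern (i j k : Fin n) (v : TM n M) : ℝ :=
  1 / 2 * ∑ l, F.gInv φ i l v *
    (delta φ (F.metricN φ) k (F.gComp φ l j) v + delta φ (F.metricN φ) j (F.gComp φ l k) v
      - delta φ (F.metricN φ) l (F.gComp φ j k) v)

/-- The metric volume form `√|det g_{ab}| dx¹ ∧ … ∧ dxⁿ` on the domain of the chart `φ`, oriented
by `φ`. -/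
def dVol : CovFieldA n M n := fun v =>
  √|(F.gMatrix φ v).det| •
    ∑ σ : Equiv.Perm (Fin n), (Equiv.Perm.sign σ : ℝ) • dxTensor φ v.proj σ

/-- The divergence of an anisotropic vector field: the factor `div(Z)` in
`𝔩ᴴ_Z(dVol) = div(Z) dVol`, where `H` is the metric nonlinear connection. It is read off on the
frame `∂₁, …, ∂ₙ`, which determines it as both sides are forms of top degree (see
`lieCov_dVol` below). It does not depend on the orientation. -/
def divergence (Z : VectorFieldA n M) (v : TM n M) : ℝ :=
  compCov φ (lieCov φ (F.metricN φ) Z (F.dVol φ)) id v / compCov φ (F.dVol φ) id v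

/-- The covariant derivative `∇X` for the Chern connection. -/
def nabla (X : VectorFieldA n M) : EndFieldA n M := nablaVec φ (F.chern φ) X

/-! ### The divergence is well defined by `𝔩ᴴ_Z(dVol) = div(Z) dVol` -/

section WellDefined

variable {φ}

theorem mdiff (hφ : φ ∈ IsManifold.maximalAtlas 𝓘(ℝ, Coord n) ∞ M) :
    φ.MDifferentiable 𝓘(ℝ, Coord n) 𝓘(ℝ, Coord n) :=
  ⟨(contMDiffOn_of_mem_maximalAtlas hφ).mdifferentiableOn (by simp),
    (contMDiffOn_symm_of_mem_maximalAtlas hφ).mdifferentiableOn (by simp)⟩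

theorem dx_frame (hφ : φ ∈ IsManifold.maximalAtlas 𝓘(ℝ, Coord n) ∞ M) {p : M}
    (hp : p ∈ φ.source) (i j : Fin n) :
    dx φ p i (frame φ p j) = if i = j then 1 else 0 := by
  have h := (mdiff hφ).comp_symm_deriv (φ.map_source hp)
  rw [φ.left_inv hp] at h
  have h2 := congrArg (fun L : Coord n →L[ℝ] Coord n => L (EuclideanSpace.single j (1 : ℝ)) i) h
  refine Eq.trans ?_ (h2.trans ?_)
  · rfl
  · change (EuclideanSpace.single j (1 : ℝ)) i = _
    simp

theorem sum_dx_frame (hφ : φ ∈ IsManifold.maximalAtlas 𝓘(ℝ, Coord n) ∞ M) {p : M}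
    (hp : p ∈ φ.source) (u : Tan n p) :
    u = ∑ j, dx φ p j u • frame φ p j := by
  have h := (mdiff hφ).symm_comp_deriv hp
  have h2 := congrArg (fun L : Coord n →L[ℝ] Coord n => L u) h
  refine (Eq.trans ?_ h2).symm
  set D : Coord n →L[ℝ] Coord n := mfderiv 𝓘(ℝ, Coord n) 𝓘(ℝ, Coord n) φ.symm (φ p) with hD
  set y : Coord n := mfderiv 𝓘(ℝ, Coord n) 𝓘(ℝ, Coord n) φ p u with hy
  change (∑ j, y j • D (EuclideanSpace.single j (1 : ℝ)) : Coord n) = D y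
  have : y = ∑ j, y j • EuclideanSpace.single j (1 : ℝ) := by
    ext i
    simp [Pi.single_apply]
  conv_rhs => rw [this]
  simp

theorem dxTensor_frame (hφ : φ ∈ IsManifold.maximalAtlas 𝓘(ℝ, Coord n) ∞ M) {p : M}
    (hp : p ∈ φ.source) {s : ℕ} (J K : Fin s → Fin n) :
    dxTensor φ p J (fun a => frame φ p (K a)) = if J = K then 1 else 0 := by
  simp only [dxTensor, ContinuousMultilinearMap.compContinuousLinearMap_apply,
    ContinuousMultilinearMap.mkPiAlgebra_apply, dx_frame hφ hp]
  split_ifs with h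
  · simp [h]
  · obtain ⟨a, ha⟩ := Function.ne_iff.mp h
    exact Finset.prod_eq_zero (Finset.mem_univ a) (by simp [ha])

/-- The sign of `J` if it is a permutation, and `0` otherwise. -/
def eps (J : Fin n → Fin n) : ℝ :=
  (Matrix.of fun i a : Fin n => if i = J a then (1 : ℝ) else 0).det

theorem eps_perm (σ : Equiv.Perm (Fin n)) : eps (σ : Fin n → Fin n) = Equiv.Perm.sign σ := by
  have : (Matrix.of fun i a : Fin n => if i = σ a then (1 : ℝ) else 0)
      = (σ.permMatrix ℝ).transpose := by
    ext i a
    simp [Equiv.Perm.permMatrix, PEquiv.toMatrix_apply, eq_comm]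
  rw [eps, this, Matrix.det_transpose, Matrix.det_permutation]

theorem sum_perm_dx (p : M) :
    ∑ σ : Equiv.Perm (Fin n), (Equiv.Perm.sign σ : ℝ) • dxTensor φ p σ
      = ∑ J : Fin n → Fin n, eps J • dxTensor φ p J := by
  refine Fintype.sum_of_injective (fun σ : Equiv.Perm (Fin n) => (σ : Fin n → Fin n))
    DFunLike.coe_injective _ _ ?_ ?_
  · intro J hJ
    have hinj : ¬ Function.Injective J := fun h =>
      hJ ⟨Equiv.ofBijective J (Finite.injective_iff_bijective.mp h), rfl⟩
    simp only [Function.Injective, not_forall] at hinj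
    obtain ⟨a, b, hab, hne⟩ := hinj
    have : eps J = 0 := Matrix.det_zero_of_column_eq hne (by intro i; simp [hab])
    simp [this]
  · intro σ
    simp [eps_perm]

theorem dVol_eq (v : TM n M) : F.dVol φ v =
    ∑ J : Fin n → Fin n, (√|(F.gMatrix φ v).det| * eps J) • dxTensor φ v.proj J := by
  rw [dVol, sum_perm_dx, Finset.smul_sum]
  simp [smul_smul]

theorem compCov_sum (hφ : φ ∈ IsManifold.maximalAtlas 𝓘(ℝ, Coord n) ∞ M) {s : ℕ}
    (S : CovFieldA n M s) (c : (Fin s → Fin n) → ℝ) {v : TM n M} (hv : v.proj ∈ φ.source)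
    (hS : S v = ∑ J, c J • dxTensor φ v.proj J) (K : Fin s → Fin n) : compCov φ S K v = c K := by
  simp [compCov, hS, dxTensor_frame hφ hv]

theorem delta_const_mul (N : Fin n → Fin n → TM n M → ℝ) (k : Fin n)
    (f h : TM n M → ℝ) (c : ℝ) (hf : ∀ w : TM n M, w.proj ∈ φ.source → f w = c * h w)
    {v : TM n M} (hv : v.proj ∈ φ.source) : delta φ N k f v = c * delta φ N k h v := by
  have key : ∀ (q r : Coord n → ℝ) (z : Coord n), q =ᶠ[𝓝 z] (c • r) →
      fderiv ℝ q z (EuclideanSpace.single k 1) = c * fderiv ℝ r z (EuclideanSpace.single k 1) := by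
    intro q r z hq
    rw [hq.fderiv_eq, fderiv_const_smul_field]
    simp
  have h1 : partialX φ k f v = c * partialX φ k h v := by
    refine key _ _ _ ?_
    filter_upwards [φ.open_target.mem_nhds (φ.map_source hv)] with x hx
    exact hf _ (φ.map_target hx)
  have h2 : ∀ j, partialY φ j f v = c * partialY φ j h v := by
    intro j
    have : (fun y : Coord n => f (ofCoord φ (φ v.proj) y))
        = c • (fun y : Coord n => h (ofCoord φ (φ v.proj) y)) := by
      ext y
      exact hf _ (φ.map_target (φ.map_source hv))
    rw [partialY, this, fderiv_const_smul_field]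
    simp [partialY]
  rw [delta, delta, h1, mul_sub, Finset.mul_sum]
  simp only [h2]
  congr 1
  exact Finset.sum_congr rfl fun j _ => by ring

theorem sum_eps_update (D : Fin n → Fin n → ℝ) (J : Fin n → Fin n) :
    ∑ a, ∑ k, D (J a) k * eps (Function.update J a k) = (∑ a, D a a) * eps J := by
  set P : Matrix (Fin n) (Fin n) ℝ := Matrix.of fun i a => if i = J a then (1 : ℝ) else 0 with hP
  set B : Matrix (Fin n) (Fin n) ℝ := Matrix.of fun i j => D j i with hB
  have h1 : ∀ a k, eps (Function.update J a k) = P.adjugate a k := by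
    intro a k
    have : (Matrix.of fun i b : Fin n => if i = Function.update J a k b then (1 : ℝ) else 0)
        = P.updateCol a (Pi.single k 1) := by
      ext i b
      by_cases hb : b = a
      · subst hb; simp [Pi.single_apply]
      · simp [hb, hP]
    rw [eps, this, ← Matrix.cramer_apply, Matrix.cramer_eq_adjugate_mulVec]
    simp
  have h2 : ∀ a k, D (J a) k = (B * P) k a := by
    intro a k
    simp [Matrix.mul_apply, hB, hP]
  calc ∑ a, ∑ k, D (J a) k * eps (Function.update J a k)
      = (P.adjugate * (B * P)).trace := by
        simp only [Matrix.trace, Matrix.diag, Matrix.mul_apply (M := P.adjugate), h1, h2]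
        exact Finset.sum_congr rfl fun a _ => Finset.sum_congr rfl fun k _ => mul_comm _ _
    _ = (P * P.adjugate * B).trace := by
        rw [← Matrix.mul_assoc, Matrix.trace_mul_comm, Matrix.mul_assoc]
    _ = (∑ a, D a a) * eps J := by
        rw [Matrix.mul_adjugate, Matrix.smul_mul, Matrix.one_mul, Matrix.trace_smul, smul_eq_mul,
          mul_comm]
        rfl

theorem det_gMatrix_ne_zero (hφ : φ ∈ IsManifold.maximalAtlas 𝓘(ℝ, Coord n) ∞ M) {v : TM n M}
    (hv : v ∈ F.A) (hvφ : v.proj ∈ φ.source) : (F.gMatrix φ v).det ≠ 0 := by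
  intro h0
  obtain ⟨c, hc, hc0⟩ := Matrix.exists_vecMul_eq_zero_iff.mpr h0
  have lin1 : ∀ (w : Tan n v.proj) (d : Fin n → ℝ),
      F.g v ![∑ j, d j • frame φ v.proj j, w] = ∑ j, d j * F.g v ![frame φ v.proj j, w] := by
    intro w d
    set l := (F.g v).toMultilinearMap.toLinearMap ![0, w] 0 with hl
    have e : ∀ u, F.g v ![u, w] = l u := fun u => by
      change F.g v _ = F.g v _
      congr 1
      funext a
      fin_cases a <;> rfl
    simp only [e, map_sum, map_smul, smul_eq_mul]
  have lin2 : ∀ (w : Tan n v.proj) (d : Fin n → ℝ),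
      F.g v ![w, ∑ j, d j • frame φ v.proj j] = ∑ j, d j * F.g v ![w, frame φ v.proj j] := by
    intro w d
    set l := (F.g v).toMultilinearMap.toLinearMap ![w, 0] 1 with hl
    have e : ∀ u, F.g v ![w, u] = l u := fun u => by
      change F.g v _ = F.g v _
      congr 1
      funext a
      fin_cases a <;> rfl
    simp only [e, map_sum, map_smul, smul_eq_mul]
  have hu := F.nondegenerate v hv (∑ j, c j • frame φ v.proj j) (by
    intro w
    change F.g v ![_, w] = 0
    rw [sum_dx_frame hφ hvφ w, lin2]
    refine Finset.sum_eq_zero fun i _ => ?_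
    rw [lin1]
    have h3 := congrFun hc0 i
    have h4 : ∀ j, F.gMatrix φ v j i = F.g v ![frame φ v.proj j, frame φ v.proj i] := by
      intro j
      change F.g v _ = _
      congr 1
      ext a
      fin_cases a <;> rfl
    simp only [Matrix.vecMul, dotProduct, h4, Pi.zero_apply] at h3
    rw [h3, mul_zero])
  apply hc
  ext i
  have h5 := congrArg (dx φ v.proj i) hu
  simpa [dx_frame hφ hvφ] using h5

/-- `𝔩ᴴ_Z(dVol) = div(Z) dVol`. -/
theorem lieCov_dVol (hφ : φ ∈ IsManifold.maximalAtlas 𝓘(ℝ, Coord n) ∞ M) (Z : VectorFieldA n M)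
    {v : TM n M} (hv : v ∈ F.A) (hvφ : v.proj ∈ φ.source) :
    lieCov φ (F.metricN φ) Z (F.dVol φ) v = F.divergence φ Z v • F.dVol φ v := by
  have hcomp : ∀ w : TM n M, w.proj ∈ φ.source → ∀ J : Fin n → Fin n,
      compCov φ (F.dVol φ) J w = √|(F.gMatrix φ w).det| * eps J :=
    fun w hw J => compCov_sum hφ _ _ hw (F.dVol_eq w) J
  have hid : eps (id : Fin n → Fin n) = 1 := by
    simpa using eps_perm (1 : Equiv.Perm (Fin n))
  have hpos : √|(F.gMatrix φ v).det| ≠ 0 :=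
    (Real.sqrt_pos.mpr (abs_pos.mpr (F.det_gMatrix_ne_zero hφ hv hvφ))).ne'
  obtain ⟨q, hq⟩ : ∃ q : ℝ, lieCov φ (F.metricN φ) Z (F.dVol φ) v =
      ∑ J : Fin n → Fin n, (q * eps J) • dxTensor φ v.proj J := by
    refine ⟨(∑ k, compVec φ Z k v *
      delta φ (F.metricN φ) k (fun w => √|(F.gMatrix φ w).det|) v) +
      √|(F.gMatrix φ v).det| * ∑ a, delta φ (F.metricN φ) a (compVec φ Z a) v, ?_⟩
    refine Finset.sum_congr rfl fun J _ => ?_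
    congr 1
    have e1 : ∀ k, delta φ (F.metricN φ) k (compCov φ (F.dVol φ) J) v =
        eps J * delta φ (F.metricN φ) k (fun w => √|(F.gMatrix φ w).det|) v := fun k =>
      delta_const_mul _ _ _ _ _ (fun w hw => by rw [hcomp w hw, mul_comm]) hvφ
    simp only [e1, hcomp v hvφ]
    rw [add_mul, mul_assoc, ← sum_eps_update (fun j k => delta φ (F.metricN φ) j (compVec φ Z k) v),
      Finset.sum_mul, Finset.mul_sum]
    congr 1
    · exact Finset.sum_congr rfl fun k _ => by ring
    · refine Finset.sum_congr rfl fun a _ => ?_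
      rw [Finset.mul_sum]
      exact Finset.sum_congr rfl fun k _ => by ring
  have hdiv : F.divergence φ Z v = q / √|(F.gMatrix φ v).det| := by
    rw [divergence, compCov_sum hφ _ _ hvφ hq, hcomp v hvφ, hid, mul_one, mul_one]
  rw [hq, hdiv, dVol_eq, Finset.smul_sum]
  refine Finset.sum_congr rfl fun J _ => ?_
  rw [smul_smul]
  congr 1
  field_simp

end WellDefined

end PseudoFinslerMetric

end AnisotropicTensors

end

/-!
Since the Chern connection is torsion-free and its underlying nonlinear connection is the metric
one, `𝔩ᴴ_X S - ∇_X S` is the endomorphism `∇X` acting on `S` as a derivation; on a symmetric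
2-tensor this vanishes exactly when `∇X` is skew-adjoint. The same connection makes `g`, hence
`dVol`, parallel, so that `div Z = trace ∇Z`, and the divergence formula is the trace of the
Leibniz rule `∇(T X) = (∇T) X + T ∇X`. Finally, a skew-adjoint endomorphism is traceless, and so
is the product of a self-adjoint and a skew-adjoint one, because adjoint endomorphisms have the
same trace.

That the underlying nonlinear connection is the metric one rests on the homogeneity of `L`, which
gives `C_{ijk} yᵏ = 0` by Euler's theorem.
-/

noncomputable section

namespace AnisotropicTensors

section AdjointTraces

variable {K V : Type*} [Field K] [AddCommGroup V] [Module K V] [FiniteDimensional K V]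
  {B : LinearMap.BilinForm K V} {f g : Module.End K V}

theorem trace_eq_of_isAdjointPair (hB : B.SeparatingLeft) (h : B.IsAdjointPair B f g) :
    LinearMap.trace K V f = LinearMap.trace K V g := by
  let e : V ≃ₗ[K] Module.Dual K V := B.linearEquivOfInjective
    (LinearMap.ker_eq_bot.mp (LinearMap.separatingLeft_iff_ker_eq_bot.mp hB))
    Subspace.dual_finrank_eq.symm
  have hconj : e.conj f = Module.Dual.transpose g := by
    refine LinearMap.ext fun ξ => LinearMap.ext fun y => ?_
    obtain ⟨x, rfl⟩ := e.surjective ξ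
    rw [LinearEquiv.conj_apply_apply, e.symm_apply_apply]
    exact h x y
  rw [← LinearMap.trace_conj' f e, hconj, LinearMap.trace_transpose']

variable [NeZero (2 : K)]

theorem trace_eq_zero_of_isSkewAdjoint (hB : B.SeparatingLeft) (h : B.IsSkewAdjoint f) :
    LinearMap.trace K V f = 0 := by
  have htrace := trace_eq_of_isAdjointPair (g := -f) hB h
  rwa [map_neg, eq_neg_iff_add_eq_zero, ← two_mul, mul_eq_zero_iff_left two_ne_zero] at htrace

theorem trace_mul_eq_zero_of_isSelfAdjoint_of_isSkewAdjoint (hB : B.SeparatingLeft)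
    (hf : B.IsSelfAdjoint f) (hg : B.IsSkewAdjoint g) : LinearMap.trace K V (f * g) = 0 := by
  have hpair : B.IsAdjointPair B ↑(f * g) ↑(-(g * f)) := fun x y => by
    rw [Module.End.mul_apply, hf, hg]
    rfl
  have htrace := trace_eq_of_isAdjointPair hB hpair
  rwa [map_neg, LinearMap.trace_mul_comm K g f, eq_neg_iff_add_eq_zero, ← two_mul,
    mul_eq_zero_iff_left two_ne_zero] at htrace

end AdjointTraces

section MultilinearForms

variable {R V : Type*} [CommRing R] [TopologicalSpace R] [AddCommGroup V] [Module R V]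
  [TopologicalSpace V]

/-- A continuous multilinear form in two variables, as a bilinear form. -/
def bilinForm (S : ContinuousMultilinearMap R (fun _ : Fin 2 => V) R) : LinearMap.BilinForm R V :=
  (MultilinearMap.ofSubsingletonₗ R R V R 0).symm.toLinearMap ∘ₗ S.toMultilinearMap.curryLeft

theorem bilinForm_apply (S : ContinuousMultilinearMap R (fun _ : Fin 2 => V) R) (a b : V) :
    bilinForm S a b = S ![a, b] := by
  change S (Fin.cons a fun _ => b) = _
  congr 1
  ext i
  fin_cases i <;> rfl

variable [ContinuousAdd R]

/-- The endomorphism `L` acting on the covariant tensor `S` as a derivation, without the minus sign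
of the dual representation: `L` is inserted in each argument in turn and the results are added. -/
def derivAction {s : ℕ} (L : V →L[R] V)
    (S : ContinuousMultilinearMap R (fun _ : Fin s => V) R) :
    ContinuousMultilinearMap R (fun _ : Fin s => V) R :=
  ∑ a, S.compContinuousLinearMap (Function.update (fun _ => ContinuousLinearMap.id R V) a L)

theorem derivAction_apply {s : ℕ} (L : V →L[R] V)
    (S : ContinuousMultilinearMap R (fun _ : Fin s => V) R) (w : Fin s → V) :
    derivAction L S w = ∑ a, S (Function.update w a (L (w a))) := by
  rw [derivAction, sum_apply]
  refine Finset.sum_congr rfl fun a _ => congrArg S (funext fun b => ?_)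
  obtain rfl | hb := eq_or_ne b a
  · simp
  · simp [hb]

theorem derivAction_two (L : V →L[R] V)
    (S : ContinuousMultilinearMap R (fun _ : Fin 2 => V) R) (a b : V) :
    derivAction L S ![a, b] = S ![L a, b] + S ![a, L b] := by
  rw [derivAction_apply, Fin.sum_univ_two]
  congr 2 <;> ext i <;> fin_cases i <;> rfl

end MultilinearForms

section Calculus

theorem hasDerivAt_sqrt_abs {x : ℝ} (hx : x ≠ 0) :
    HasDerivAt (fun t : ℝ => √|t|) (√|x| / (2 * x)) x := by
  have hsqrt : √|x| ≠ 0 := (Real.sqrt_pos.mpr (abs_pos.mpr hx)).ne'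
  refine ((hasDerivAt_abs hx).sqrt (abs_ne_zero.mpr hx)).congr_deriv ?_
  field_simp
  rw [sign_mul_self, Real.sq_sqrt (abs_nonneg x)]

variable {𝕜 E F ι : Type*} [NontriviallyNormedField 𝕜] [NormedAddCommGroup E] [NormedSpace 𝕜 E]
  [NormedAddCommGroup F] [NormedSpace 𝕜 F]

theorem fderiv_smul_of_homogeneous {f : E → F} {c : 𝕜} (hc : c ≠ 0) {d : ℕ} {y : E}
    (hf : ∀ᶠ w in 𝓝 y, f (c • w) = c ^ (d + 1) • f w) :
    fderiv 𝕜 f (c • y) = c ^ d • fderiv 𝕜 f y := by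
  refine smul_right_injective _ hc ?_
  calc c • fderiv 𝕜 f (c • y) = fderiv 𝕜 (fun w => f (c • w)) y := (fderiv_comp_smul c).symm
    _ = fderiv 𝕜 (c ^ (d + 1) • f) y := Filter.EventuallyEq.fderiv_eq hf
    _ = c • c ^ d • fderiv 𝕜 f y := by rw [fderiv_const_smul_field, pow_succ', mul_smul]; rfl

theorem fderiv_fderiv_smul_of_homogeneous {f : E → F} {c : 𝕜} (hc : c ≠ 0) {y : E}
    (hf : ∀ᶠ w in 𝓝 y, f (c • w) = c ^ 2 • f w) :
    fderiv 𝕜 (fderiv 𝕜 f) (c • y) = fderiv 𝕜 (fderiv 𝕜 f) y := by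
  have hfderiv : ∀ᶠ w in 𝓝 y, fderiv 𝕜 f (c • w) = c ^ (0 + 1) • fderiv 𝕜 f w :=
    hf.eventually_nhds.mono fun w hw => fderiv_smul_of_homogeneous hc hw
  rw [fderiv_smul_of_homogeneous hc hfderiv, pow_zero, one_smul]

theorem fderiv_fderiv_apply {f : E → F} {y : E} (hf : DifferentiableAt 𝕜 (fderiv 𝕜 f) y)
    (u w : E) : fderiv 𝕜 (fun x => fderiv 𝕜 f x u) y w = fderiv 𝕜 (fderiv 𝕜 f) y w u := by
  rw [fderiv_clm_apply hf (differentiableAt_const u)]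
  simp

theorem hasFDerivAt_det [Fintype ι] [DecidableEq ι] {A : E → Matrix ι ι 𝕜}
    {A' : ι → ι → E →L[𝕜] 𝕜} {z : E}
    (hA : ∀ i j, HasFDerivAt (fun w => A w i j) (A' i j) z) :
    HasFDerivAt (fun w => (A w).det) (∑ i, ∑ j, (A z).adjugate j i • A' i j) z := by
  let detForm : ContinuousMultilinearMap 𝕜 (fun _ : ι => ι → 𝕜) 𝕜 :=
    { Matrix.detRowAlternating.toMultilinearMap with
      cont := Continuous.matrix_det continuous_id }
  have hrow : ∀ i, HasFDerivAt (fun w => A w i) (ContinuousLinearMap.pi (A' i)) z :=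
    fun i => hasFDerivAt_pi.mpr (hA i)
  refine (HasFDerivAt.multilinear_comp detForm hrow).congr_fderiv ?_
  ext w
  simp only [sum_apply, ContinuousLinearMap.comp_apply, smul_apply, smul_eq_mul]
  refine Finset.sum_congr rfl fun i _ => ?_
  change ((A z).updateRow i (fun j => A' i j w)).det = _
  rw [← Matrix.cramer_transpose_apply, Matrix.cramer_eq_adjugate_mulVec,
    ← Matrix.adjugate_transpose]
  rfl

theorem fderiv_apply_self_eq_zero_of_homogeneous {E F : Type*} [NormedAddCommGroup E]
    [NormedSpace ℝ E] [NormedAddCommGroup F] [NormedSpace ℝ F] {f : E → F} {y : E}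
    (hf : ∀ c : ℝ, 0 < c → f (c • y) = f y) : fderiv ℝ f y y = 0 := by
  by_cases hd : DifferentiableAt ℝ f y
  · have hray : HasDerivAt (fun c : ℝ => c • y) y 1 := by
      simpa using (hasDerivAt_id (1 : ℝ)).smul_const y
    have hcomp : HasDerivAt (fun c : ℝ => f (c • y)) (fderiv ℝ f y y) 1 := by
      refine HasFDerivAt.comp_hasDerivAt (1 : ℝ) ?_ hray
      simpa using hd.hasFDerivAt
    refine hcomp.unique ((hasDerivAt_const (1 : ℝ) (f y)).congr_of_eventuallyEq ?_)
    filter_upwards [eventually_gt_nhds zero_lt_one] with c hc using hf c hc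
  · rw [fderiv_zero_of_not_differentiableAt hd]
    rfl

end Calculus

section ChartCalculus

variable {n : ℕ} {M : Type*} [TopologicalSpace M] [ChartedSpace (Coord n) M]

/-- The coordinate expression `(x, y) ↦ f(x, y)` of a function `f` on `TM`. -/
def localRep (φ : OpenPartialHomeomorph M (Coord n)) (f : TM n M → ℝ) (z : Coord n × Coord n) : ℝ :=
  f (ofCoord φ z.1 z.2)

/-- The restriction of `f` to `T_pM`, as a function on the model space. -/
def fibreRestrict {α : Type*} (f : TM n M → α) (p : M) (y : Coord n) : α :=
  f ⟨p, y⟩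

/-- The coordinates `(x, y)` of `v`. -/
def coordOf (φ : OpenPartialHomeomorph M (Coord n)) (v : TM n M) : Coord n × Coord n :=
  (φ v.proj, fiberCoord φ v)

/-- The coordinate expression of the part of `A ⊆ TM` over the chart domain. -/
def localDomain (φ : OpenPartialHomeomorph M (Coord n)) (A : Set (TM n M)) :
    Set (Coord n × Coord n) :=
  {z | z.1 ∈ φ.target ∧ ofCoord φ z.1 z.2 ∈ A}

/-- The `k`-th horizontal vector `δₖ = ∂/∂xᵏ - Nₖʲ ∂/∂yʲ` at `v`, in coordinates. -/
def horizontal (N : Fin n → Fin n → TM n M → ℝ) (k : Fin n) (v : TM n M) : Coord n × Coord n :=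
  (EuclideanSpace.single k 1, -∑ j, N j k v • EuclideanSpace.single j (1 : ℝ))

variable {φ : OpenPartialHomeomorph M (Coord n)} {f f₁ f₂ : TM n M → ℝ} {v : TM n M}

theorem partialX_of_hasFDerivAt {f' : Coord n × Coord n →L[ℝ] ℝ} (k : Fin n)
    (hf : HasFDerivAt (localRep φ f) f' (coordOf φ v)) :
    partialX φ k f v = f' (EuclideanSpace.single k 1, 0) := by
  have hcomp := hf.comp (φ v.proj) (hasFDerivAt_prodMk_left (𝕜 := ℝ) (φ v.proj) (fiberCoord φ v))
  exact congrArg (fun D : Coord n →L[ℝ] ℝ => D (EuclideanSpace.single k 1)) hcomp.fderiv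

theorem partialY_of_hasFDerivAt {f' : Coord n × Coord n →L[ℝ] ℝ} (k : Fin n)
    (hf : HasFDerivAt (localRep φ f) f' (coordOf φ v)) :
    partialY φ k f v = f' (0, EuclideanSpace.single k 1) := by
  have hcomp := hf.comp (fiberCoord φ v)
    (hasFDerivAt_prodMk_right (𝕜 := ℝ) (φ v.proj) (fiberCoord φ v))
  exact congrArg (fun D : Coord n →L[ℝ] ℝ => D (EuclideanSpace.single k 1)) hcomp.fderiv

theorem partialX_congr (k : Fin n) (h : localRep φ f₁ =ᶠ[𝓝 (coordOf φ v)] localRep φ f₂) :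
    partialX φ k f₁ v = partialX φ k f₂ v :=
  congrArg (fun D : Coord n →L[ℝ] ℝ => D (EuclideanSpace.single k 1))
    (Filter.EventuallyEq.fderiv_eq
      ((Continuous.prodMk_left (fiberCoord φ v)).continuousAt.eventually h))

theorem partialY_congr (k : Fin n) (h : localRep φ f₁ =ᶠ[𝓝 (coordOf φ v)] localRep φ f₂) :
    partialY φ k f₁ v = partialY φ k f₂ v :=
  congrArg (fun D : Coord n →L[ℝ] ℝ => D (EuclideanSpace.single k 1))
    (Filter.EventuallyEq.fderiv_eq
      ((Continuous.prodMk_right (φ v.proj)).continuousAt.eventually h))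

section Delta

variable {N : Fin n → Fin n → TM n M → ℝ} {k : Fin n}

theorem delta_congr (h : localRep φ f₁ =ᶠ[𝓝 (coordOf φ v)] localRep φ f₂) :
    delta φ N k f₁ v = delta φ N k f₂ v := by
  simp only [delta, partialX_congr _ h, partialY_congr _ h]

theorem delta_congr_connection {N' : Fin n → Fin n → TM n M → ℝ} (h : ∀ i j, N i j v = N' i j v) :
    delta φ N k f v = delta φ N' k f v := by
  simp only [delta, h]

theorem delta_of_hasFDerivAt {f' : Coord n × Coord n →L[ℝ] ℝ}
    (hf : HasFDerivAt (localRep φ f) f' (coordOf φ v)) :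
    delta φ N k f v = f' (horizontal N k v) := by
  have hhor : horizontal N k v = (EuclideanSpace.single k (1 : ℝ), (0 : Coord n))
      - ∑ j, N j k v • ((0 : Coord n), EuclideanSpace.single j (1 : ℝ)) := by
    ext <;> simp [horizontal, Prod.fst_sum, Prod.snd_sum]
  simp only [delta, hhor, partialX_of_hasFDerivAt _ hf, partialY_of_hasFDerivAt _ hf, map_sub,
    map_sum, map_smul, smul_eq_mul]

theorem delta_sum_mul {ι : Type*} [Fintype ι] {a b : ι → TM n M → ℝ}
    (ha : ∀ l, DifferentiableAt ℝ (localRep φ (a l)) (coordOf φ v))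
    (hb : ∀ l, DifferentiableAt ℝ (localRep φ (b l)) (coordOf φ v))
    (hv : ofCoord φ (coordOf φ v).1 (coordOf φ v).2 = v) :
    delta φ N k (fun w => ∑ l, a l w * b l w) v =
      ∑ l, (delta φ N k (a l) v * b l v + a l v * delta φ N k (b l) v) := by
  have hsum := HasFDerivAt.fun_sum fun l (_ : l ∈ Finset.univ) =>
    (ha l).hasFDerivAt.mul (hb l).hasFDerivAt
  rw [delta_of_hasFDerivAt hsum]
  simp only [delta_of_hasFDerivAt (ha _).hasFDerivAt, delta_of_hasFDerivAt (hb _).hasFDerivAt,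
    sum_apply, add_apply, smul_apply, smul_eq_mul]
  refine Finset.sum_congr rfl fun l _ => ?_
  rw [localRep, localRep, hv]
  ring

theorem delta_comp {ψ : ℝ → ℝ} {ψ' : ℝ} (hψ : HasDerivAt ψ ψ' (f v))
    (hf : DifferentiableAt ℝ (localRep φ f) (coordOf φ v))
    (hv : ofCoord φ (coordOf φ v).1 (coordOf φ v).2 = v) :
    delta φ N k (fun w => ψ (f w)) v = ψ' * delta φ N k f v := by
  rw [← congrArg f hv] at hψ
  have hcomp : HasFDerivAt (localRep φ fun w => ψ (f w)) _ _ :=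
    HasDerivAt.comp_hasFDerivAt (f := localRep φ f) _ hψ hf.hasFDerivAt
  rw [delta_of_hasFDerivAt hcomp, delta_of_hasFDerivAt hf.hasFDerivAt]
  rfl

theorem differentiableAt_localRep_det {G : TM n M → Matrix (Fin n) (Fin n) ℝ}
    (hG : ∀ i j, DifferentiableAt ℝ (localRep φ fun w => G w i j) (coordOf φ v)) :
    DifferentiableAt ℝ (localRep φ fun w => (G w).det) (coordOf φ v) :=
  (hasFDerivAt_det (A := fun z : Coord n × Coord n => G (ofCoord φ z.1 z.2))
    fun i j => (hG i j).hasFDerivAt).differentiableAt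

theorem delta_det {G : TM n M → Matrix (Fin n) (Fin n) ℝ}
    (hG : ∀ i j, DifferentiableAt ℝ (localRep φ fun w => G w i j) (coordOf φ v))
    (hv : ofCoord φ (coordOf φ v).1 (coordOf φ v).2 = v) :
    delta φ N k (fun w => (G w).det) v =
      ((G v).adjugate * Matrix.of fun i j => delta φ N k (fun w => G w i j) v).trace := by
  have hdet := hasFDerivAt_det (A := fun z : Coord n × Coord n => G (ofCoord φ z.1 z.2))
    fun i j => (hG i j).hasFDerivAt
  rw [delta_of_hasFDerivAt hdet, hv]
  simp only [Matrix.trace, Matrix.diag, Matrix.mul_apply, Matrix.of_apply,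
    delta_of_hasFDerivAt (hG _ _).hasFDerivAt, sum_apply, smul_apply, smul_eq_mul]
  exact Finset.sum_comm

end Delta

end ChartCalculus

section ManifoldCharts

variable {n : ℕ} {M : Type*} [TopologicalSpace M] [ChartedSpace (Coord n) M]
  [IsManifold 𝓘(ℝ, Coord n) ∞ M] {φ : OpenPartialHomeomorph M (Coord n)}
  (hφ : φ ∈ IsManifold.maximalAtlas 𝓘(ℝ, Coord n) ∞ M)
include hφ

/-- The linear isomorphism `y ↦ yⁱ ∂ᵢ` onto `T_pM`, which is the model space by definition. -/
def fibreEquiv {p : M} (hp : p ∈ φ.source) : Coord n ≃L[ℝ] Coord n :=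
  (PseudoFinslerMetric.mdiff hφ).symm.mfderiv (φ.map_source hp)

theorem fibreEquiv_fiberCoord {v : TM n M} (hv : v.proj ∈ φ.source) :
    fibreEquiv hφ hv (fiberCoord φ v) = v.2 :=
  congrArg (fun D : Coord n →L[ℝ] Coord n => D v.2)
    ((PseudoFinslerMetric.mdiff hφ).symm_comp_deriv hv)

theorem ofCoord_apply {p : M} (hp : p ∈ φ.source) (y : Coord n) :
    ofCoord φ (φ p) y = ⟨p, fibreEquiv hφ hp y⟩ := by
  have hmk : ∀ (q : M) (w : Coord n), q = p → (⟨q, w⟩ : TM n M) = ⟨p, w⟩ := by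
    rintro q w rfl
    rfl
  exact hmk _ _ (φ.left_inv hp)

theorem ofCoord_coordOf {v : TM n M} (hv : v.proj ∈ φ.source) :
    ofCoord φ (coordOf φ v).1 (coordOf φ v).2 = v :=
  (ofCoord_apply hφ hv _).trans <|
    congrArg (Bundle.TotalSpace.mk v.proj) (fibreEquiv_fiberCoord hφ hv)

theorem coordOf_ofCoord {z : Coord n × Coord n} (hz : z.1 ∈ φ.target) :
    coordOf φ (ofCoord φ z.1 z.2) = z :=
  Prod.ext (φ.right_inv hz) <| congrArg (fun D : Coord n →L[ℝ] Coord n => D z.2)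
    ((PseudoFinslerMetric.mdiff hφ).comp_symm_deriv hz)

theorem contMDiffOn_ofCoord :
    ContMDiffOn 𝓘(ℝ, Coord n × Coord n) 𝓘(ℝ, Coord n).tangent ∞
      (fun z : Coord n × Coord n => ofCoord φ z.1 z.2) (φ.target ×ˢ Set.univ) := by
  have htangentMap := (contMDiffOn_symm_of_mem_maximalAtlas hφ).contMDiffOn_tangentMapWithin
    (m := ∞) (by simp) φ.open_target.uniqueMDiffOn
  have hmk : ContMDiff 𝓘(ℝ, Coord n × Coord n) 𝓘(ℝ, Coord n).tangent ∞
      (fun z : Coord n × Coord n => (⟨z.1, z.2⟩ : TangentBundle 𝓘(ℝ, Coord n) (Coord n))) := by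
    rw [modelWithCornersSelf_prod]
    exact contMDiff_tangentBundleModelSpaceHomeomorph_symm (I := 𝓘(ℝ, Coord n)) (n := ∞)
  refine (htangentMap.comp (s := φ.target ×ˢ Set.univ) hmk.contMDiffOn fun z hz => hz.1).congr
    fun z hz => ?_
  change _ = tangentMapWithin 𝓘(ℝ, Coord n) 𝓘(ℝ, Coord n) φ.symm φ.target ⟨z.1, z.2⟩
  rw [tangentMapWithin_eq_tangentMap (φ.open_target.uniqueMDiffOn _ hz.1)
    ((PseudoFinslerMetric.mdiff hφ).mdifferentiableAt_symm hz.1)]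
  rfl

theorem localDomain_mem_nhds {A : Set (TM n M)} (hA : IsOpen A) {v : TM n M} (hv : v ∈ A)
    (hvφ : v.proj ∈ φ.source) : localDomain φ A ∈ 𝓝 (coordOf φ v) := by
  have hopen := (contMDiffOn_ofCoord hφ).continuousOn.isOpen_inter_preimage
    (φ.open_target.prod isOpen_univ) hA
  refine Filter.mem_of_superset (hopen.mem_nhds ⟨⟨φ.map_source hvφ, trivial⟩, ?_⟩)
    fun z hz => ⟨hz.1.1, hz.2⟩
  rwa [Set.mem_preimage, ofCoord_coordOf hφ hvφ]

theorem localRep_eventuallyEq {A : Set (TM n M)} (hA : IsOpen A) {f₁ f₂ : TM n M → ℝ}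
    (h : ∀ w ∈ A, w.proj ∈ φ.source → f₁ w = f₂ w) {v : TM n M} (hv : v ∈ A)
    (hvφ : v.proj ∈ φ.source) : localRep φ f₁ =ᶠ[𝓝 (coordOf φ v)] localRep φ f₂ := by
  filter_upwards [localDomain_mem_nhds hφ hA hv hvφ] with z hz
  exact h _ hz.2 (φ.map_target hz.1)

theorem contDiffAt_localRep {A : Set (TM n M)} (hA : IsOpen A) {f : TM n M → ℝ}
    (hf : ContMDiffOn 𝓘(ℝ, Coord n).tangent 𝓘(ℝ, ℝ) ∞ f (A ∩ {v | v.proj ∈ φ.source}))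
    {v : TM n M} (hv : v ∈ A) (hvφ : v.proj ∈ φ.source) :
    ContDiffAt ℝ ∞ (localRep φ f) (coordOf φ v) := by
  refine ContDiffOn.contDiffAt (s := localDomain φ A) ?_ (localDomain_mem_nhds hφ hA hv hvφ)
  rw [← contMDiffOn_iff_contDiffOn]
  exact hf.comp ((contMDiffOn_ofCoord hφ).mono fun z hz => ⟨hz.1, trivial⟩)
    fun z hz => ⟨hz.2, φ.map_target hz.1⟩

theorem differentiableAt_localRep {A : Set (TM n M)} (hA : IsOpen A) {f : TM n M → ℝ}
    (hf : ContMDiffOn 𝓘(ℝ, Coord n).tangent 𝓘(ℝ, ℝ) ∞ f (A ∩ {v | v.proj ∈ φ.source}))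
    {v : TM n M} (hv : v ∈ A) (hvφ : v.proj ∈ φ.source) :
    DifferentiableAt ℝ (localRep φ f) (coordOf φ v) :=
  (contDiffAt_localRep hφ hA hf hv hvφ).differentiableAt (by simp)

section Frame

variable {p : M} (hp : p ∈ φ.source)
include hp

/-- The coordinate frame `∂₁, …, ∂ₙ` as a basis of `T_pM`. -/
def frameBasis : Module.Basis (Fin n) ℝ (Tan n p) :=
  .ofEquivFun
    { toFun := fun u i => dx φ p i u
      map_add' := fun u w => funext fun i => map_add (dx φ p i) u w
      map_smul' := fun c u => funext fun i => map_smul (dx φ p i) c u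
      invFun := fun c => ∑ j, c j • frame φ p j
      left_inv := fun u => (PseudoFinslerMetric.sum_dx_frame hφ hp u).symm
      right_inv := fun c => by
        ext i
        simp [PseudoFinslerMetric.dx_frame hφ hp] }

theorem frameBasis_apply (j : Fin n) : frameBasis hφ hp j = frame φ p j := by
  simp [frameBasis, Pi.single_apply, ite_smul]

theorem trace_eq_sum_dx (f : Tan n p →ₗ[ℝ] Tan n p) :
    LinearMap.trace ℝ (Tan n p) f = ∑ i, dx φ p i (f (frame φ p i)) := by
  rw [LinearMap.trace_eq_matrix_trace ℝ (frameBasis hφ hp) f]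
  refine Finset.sum_congr rfl fun i _ => ?_
  rw [Matrix.diag_apply, LinearMap.toMatrix_apply, frameBasis_apply]
  rfl

theorem multilinear_ext_frame {s : ℕ}
    {R R' : ContinuousMultilinearMap ℝ (fun _ : Fin s => Tan n p) ℝ}
    (h : ∀ J : Fin s → Fin n, R (fun a => frame φ p (J a)) = R' fun a => frame φ p (J a)) :
    R = R' := by
  refine ContinuousMultilinearMap.toMultilinearMap_injective <|
    Module.Basis.ext_multilinear (fun _ => frameBasis hφ hp) fun J => ?_
  simp only [frameBasis_apply]
  exact h J

end Frame

section VerticalDerivatives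

variable {v : TM n M} (hvφ : v.proj ∈ φ.source) {f : TM n M → ℝ}
include hvφ

theorem comp_ofCoord_eq_comp_fibreEquiv {α : Type*} (f : TM n M → α) :
    (fun y : Coord n => f (ofCoord φ (φ v.proj) y)) =
      fibreRestrict f v.proj ∘ fibreEquiv hφ hvφ :=
  funext fun y => congrArg f (ofCoord_apply hφ hvφ y)

theorem contDiffAt_fibre {m : WithTop ℕ∞} (hf : ContDiffAt ℝ m (localRep φ f) (coordOf φ v)) :
    ContDiffAt ℝ m (fibreRestrict f v.proj) v.2 := by
  have hcoord : ContDiffAt ℝ m (fun y : Coord n => f (ofCoord φ (φ v.proj) y)) (fiberCoord φ v) :=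
    hf.comp (fiberCoord φ v) (contDiffAt_const.prodMk contDiffAt_id)
  rwa [comp_ofCoord_eq_comp_fibreEquiv hφ hvφ,
    ← (fibreEquiv hφ hvφ).symm_apply_apply (fiberCoord φ v),
    ContinuousLinearEquiv.contDiffAt_comp_iff, fibreEquiv_fiberCoord] at hcoord

theorem partialY_eq_fderiv_fibre (k : Fin n) (f : TM n M → ℝ) : partialY φ k f v =
    fderiv ℝ (fibreRestrict f v.proj) v.2 (frame φ v.proj k) := by
  rw [partialY, comp_ofCoord_eq_comp_fibreEquiv hφ hvφ,
    (fibreEquiv hφ hvφ).comp_right_fderiv, fibreEquiv_fiberCoord]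
  rfl

theorem sum_partialY_mul_fiberCoord (f : TM n M → ℝ) :
    ∑ k, partialY φ k f v * fiberCoord φ v k =
      fderiv ℝ (fibreRestrict f v.proj) v.2 v.2 := by
  let D : Coord n →L[ℝ] ℝ := fderiv ℝ (fibreRestrict f v.proj) v.2
  let e : Fin n → Coord n := frame φ v.proj
  calc ∑ k, partialY φ k f v * fiberCoord φ v k
      = ∑ k, fiberCoord φ v k • D (e k) := Finset.sum_congr rfl fun k _ => by
        rw [partialY_eq_fderiv_fibre hφ hvφ, smul_eq_mul, mul_comm]
    _ = D (∑ k, fiberCoord φ v k • e k) := by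
        simp only [map_sum, map_smul]
    _ = D v.2 := congrArg D (PseudoFinslerMetric.sum_dx_frame hφ hvφ v.2).symm

theorem localRep_partialY_eventuallyEq (k : Fin n)
    (hf : ContDiffAt ℝ 1 (localRep φ f) (coordOf φ v)) :
    localRep φ (partialY φ k f) =ᶠ[𝓝 (coordOf φ v)]
      fun z => fderiv ℝ (localRep φ f) z (0, EuclideanSpace.single k 1) := by
  filter_upwards [localDomain_mem_nhds hφ isOpen_univ (Set.mem_univ v) hvφ,
    hf.eventually (by simp)] with z hz hfz
  have hdiff := (hfz.differentiableAt one_ne_zero).hasFDerivAt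
  rw [← coordOf_ofCoord hφ hz.1] at hdiff
  rw [localRep, partialY_of_hasFDerivAt k hdiff, coordOf_ofCoord hφ hz.1]

theorem contDiffAt_localRep_partialY (k : Fin n) {m m' : WithTop ℕ∞}
    (hf : ContDiffAt ℝ m' (localRep φ f) (coordOf φ v)) (hm : m + 1 ≤ m') :
    ContDiffAt ℝ m (localRep φ (partialY φ k f)) (coordOf φ v) :=
  ((hf.fderiv_right hm).clm_apply contDiffAt_const).congr_of_eventuallyEq
    (localRep_partialY_eventuallyEq hφ hvφ k (hf.of_le (le_trans le_add_self hm)))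

theorem partialY_comm (i j : Fin n) (hf : ContDiffAt ℝ 2 (localRep φ f) (coordOf φ v)) :
    partialY φ i (partialY φ j f) v = partialY φ j (partialY φ i f) v := by
  have hsecond : ∀ i j, partialY φ i (partialY φ j f) v =
      fderiv ℝ (fderiv ℝ (localRep φ f)) (coordOf φ v)
        (0, EuclideanSpace.single i 1) (0, EuclideanSpace.single j 1) := fun i j => by
    have hfderiv : HasFDerivAt (fderiv ℝ (localRep φ f)) _ (coordOf φ v) :=
      ((hf.fderiv_right (m := 1) (by norm_num)).differentiableAt one_ne_zero).hasFDerivAt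
    have hpartial := (hfderiv.clm_apply (hasFDerivAt_const _ _)).congr_of_eventuallyEq
      (localRep_partialY_eventuallyEq hφ hvφ j (hf.of_le one_le_two))
    rw [partialY_of_hasFDerivAt i hpartial]
    simp
  rw [hsecond, hsecond]
  exact hf.isSymmSndFDerivAt (by simp) _ _

end VerticalDerivatives

end ManifoldCharts

namespace PseudoFinslerMetric

section FundamentalTensor

variable {n : ℕ} {M : Type*} [TopologicalSpace M] [ChartedSpace (Coord n) M]
  [IsManifold 𝓘(ℝ, Coord n) ∞ M] (F : PseudoFinslerMetric n M)
  {φ : OpenPartialHomeomorph M (Coord n)}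

theorem gComp_eq_fderiv_fderiv (i j : Fin n) (w : TM n M) : F.gComp φ i j w =
    1 / 2 * fderiv ℝ (fderiv ℝ (fibreRestrict F.L w.proj)) w.2
      (frame φ w.proj i) (frame φ w.proj j) :=
  congrArg (1 / 2 * ·) (iteratedFDeriv_two_apply (𝕜 := ℝ) (fibreRestrict F.L w.proj) w.2 _)

theorem eventually_mem_fibre {v : TM n M} (hv : v ∈ F.A) :
    ∀ᶠ y : Coord n in 𝓝 v.2, (⟨v.proj, y⟩ : TM n M) ∈ F.A :=
  (FiberBundle.continuous_totalSpaceMk (Coord n) (TangentSpace 𝓘(ℝ, Coord n) (M := M))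
    v.proj).continuousAt.eventually (F.isOpen_A.mem_nhds hv)

theorem fibreRestrict_gComp_smul {p : M} {y : Coord n} (hy : (⟨p, y⟩ : TM n M) ∈ F.A)
    {c : ℝ} (hc : 0 < c) (i j : Fin n) :
    fibreRestrict (F.gComp φ i j) p (c • y) = fibreRestrict (F.gComp φ i j) p y := by
  have hL : ∀ᶠ w in 𝓝 y, fibreRestrict F.L p (c • w) = c ^ 2 • fibreRestrict F.L p w :=
    (F.eventually_mem_fibre hy).mono fun w hw => F.homogeneous_L ⟨p, w⟩ hw c hc
  rw [fibreRestrict, fibreRestrict, gComp_eq_fderiv_fderiv, gComp_eq_fderiv_fderiv]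
  exact congrArg (fun D : Coord n →L[ℝ] Coord n →L[ℝ] ℝ => 1 / 2 * D (frame φ p i) (frame φ p j))
    (fderiv_fderiv_smul_of_homogeneous hc.ne' hL)

variable (hφ : φ ∈ IsManifold.maximalAtlas 𝓘(ℝ, Coord n) ∞ M) {v : TM n M} (hv : v ∈ F.A)
  (hvφ : v.proj ∈ φ.source)
include hφ hv hvφ

theorem contDiffAt_localRep_L : ContDiffAt ℝ ∞ (localRep φ F.L) (coordOf φ v) :=
  contDiffAt_localRep hφ F.isOpen_A (F.smooth_L.mono Set.inter_subset_left) hv hvφ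

theorem gComp_eq_partialY (i j : Fin n) :
    F.gComp φ i j v = 1 / 2 * partialY φ i (partialY φ j F.L) v := by
  have hpartial : fibreRestrict (partialY φ j F.L) v.proj =
      fun y => fderiv ℝ (fibreRestrict F.L v.proj) y (frame φ v.proj j) :=
    funext fun y => partialY_eq_fderiv_fibre hφ (v := ⟨v.proj, y⟩) hvφ j F.L
  have hdiff : DifferentiableAt ℝ (fderiv ℝ (fibreRestrict F.L v.proj)) v.2 :=
    ((contDiffAt_fibre hφ hvφ (F.contDiffAt_localRep_L hφ hv hvφ)).fderiv_right
      (m := 1) (WithTop.coe_le_coe.2 le_top)).differentiableAt one_ne_zero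
  rw [gComp_eq_fderiv_fderiv, partialY_eq_fderiv_fibre hφ hvφ i, hpartial]
  exact congrArg (1 / 2 * ·) (fderiv_fderiv_apply hdiff _ _).symm

theorem localRep_gComp_eventuallyEq (i j : Fin n) :
    localRep φ (F.gComp φ i j) =ᶠ[𝓝 (coordOf φ v)]
      localRep φ fun w => 1 / 2 * partialY φ i (partialY φ j F.L) w :=
  localRep_eventuallyEq hφ F.isOpen_A
    (fun _ hw hwφ => F.gComp_eq_partialY hφ hw hwφ i j) hv hvφ

theorem contDiffAt_localRep_partialY_L (j : Fin n) :
    ContDiffAt ℝ ∞ (localRep φ (partialY φ j F.L)) (coordOf φ v) :=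
  contDiffAt_localRep_partialY hφ hvφ j (F.contDiffAt_localRep_L hφ hv hvφ) (by simp)

theorem contDiffAt_localRep_partialY_partialY_L (i j : Fin n) :
    ContDiffAt ℝ ∞ (localRep φ (partialY φ i (partialY φ j F.L))) (coordOf φ v) :=
  contDiffAt_localRep_partialY hφ hvφ i (F.contDiffAt_localRep_partialY_L hφ hv hvφ j) (by simp)

theorem differentiableAt_gComp (i j : Fin n) :
    DifferentiableAt ℝ (localRep φ (F.gComp φ i j)) (coordOf φ v) := by
  refine DifferentiableAt.congr_of_eventuallyEq ?_ (F.localRep_gComp_eventuallyEq hφ hv hvφ i j)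
  exact ((F.contDiffAt_localRep_partialY_partialY_L hφ hv hvφ i j).differentiableAt
    (by simp)).const_mul (1 / 2 : ℝ)

theorem g_symm (a b : Tan n v.proj) : F.g v ![a, b] = F.g v ![b, a] := by
  have hL : ContDiffAt ℝ 2 (fibreRestrict F.L v.proj) v.2 :=
    (contDiffAt_fibre hφ hvφ (F.contDiffAt_localRep_L hφ hv hvφ)).of_le
      (WithTop.coe_le_coe.2 le_top)
  refine congrArg (fun r : ℝ => (1 / 2 : ℝ) * r) ?_
  refine (iteratedFDeriv_two_apply (fibreRestrict F.L v.proj) v.2 ![a, b]).trans <|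
    Eq.trans ?_ (iteratedFDeriv_two_apply (fibreRestrict F.L v.proj) v.2 ![b, a]).symm
  exact hL.isSymmSndFDerivAt (by simp) a b

theorem gComp_symm (i j : Fin n) : F.gComp φ i j v = F.gComp φ j i v := by
  have hpair : ∀ i j, F.gComp φ i j v = F.g v ![frame φ v.proj i, frame φ v.proj j] := fun i j =>
    congrArg (F.g v) (FinVec.etaExpand_eq _).symm
  rw [hpair, hpair, F.g_symm hφ hv hvφ]

theorem localRep_gComp_symm (i j : Fin n) :
    localRep φ (F.gComp φ i j) =ᶠ[𝓝 (coordOf φ v)] localRep φ (F.gComp φ j i) :=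
  localRep_eventuallyEq hφ F.isOpen_A (fun _ hw hwφ => F.gComp_symm hφ hw hwφ i j) hv hvφ

theorem cartan_swap_left (i j k : Fin n) : F.cartan φ i j k v = F.cartan φ j i k v := by
  rw [cartan, cartan, partialY_congr k (F.localRep_gComp_symm hφ hv hvφ i j)]

theorem cartan_eq_partialY (i j k : Fin n) : F.cartan φ i j k v =
    1 / 4 * partialY φ k (partialY φ i (partialY φ j F.L)) v := by
  have hL := ((F.contDiffAt_localRep_partialY_partialY_L hφ hv hvφ i j).differentiableAt
    (by simp)).hasFDerivAt
  have hhalf : HasFDerivAt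
      (localRep φ fun w => 1 / 2 * partialY φ i (partialY φ j F.L) w) _ (coordOf φ v) :=
    hL.const_mul (1 / 2 : ℝ)
  rw [cartan, partialY_congr k (F.localRep_gComp_eventuallyEq hφ hv hvφ i j),
    partialY_of_hasFDerivAt k hhalf, partialY_of_hasFDerivAt k hL]
  simp only [smul_apply, smul_eq_mul]
  ring

theorem cartan_rotate (i j k : Fin n) : F.cartan φ i j k v = F.cartan φ k j i v := by
  rw [F.cartan_eq_partialY hφ hv hvφ, F.cartan_eq_partialY hφ hv hvφ, partialY_comm hφ hvφ k i
    ((F.contDiffAt_localRep_partialY_L hφ hv hvφ j).of_le (WithTop.coe_le_coe.2 le_top))]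

theorem sum_cartan_mul_fiberCoord (i j : Fin n) :
    ∑ k, F.cartan φ i k j v * fiberCoord φ v k = 0 := by
  have hradial := fderiv_apply_self_eq_zero_of_homogeneous
    fun c hc => F.fibreRestrict_gComp_smul (φ := φ) (p := v.proj) (y := v.2) hv hc i j
  calc ∑ k, F.cartan φ i k j v * fiberCoord φ v k
      = ∑ k, 1 / 2 * (partialY φ k (F.gComp φ i j) v * fiberCoord φ v k) :=
        Finset.sum_congr rfl fun k _ => by
          rw [F.cartan_swap_left hφ hv hvφ, F.cartan_rotate hφ hv hvφ,
            F.cartan_swap_left hφ hv hvφ, cartan, mul_assoc]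
    _ = 0 := by rw [← Finset.mul_sum, sum_partialY_mul_fiberCoord hφ hvφ, hradial, mul_zero]

end FundamentalTensor

end PseudoFinslerMetric

namespace PseudoFinslerMetric

section ChernConnection

variable {n : ℕ} {M : Type*} [TopologicalSpace M] [ChartedSpace (Coord n) M]
  [IsManifold 𝓘(ℝ, Coord n) ∞ M] (F : PseudoFinslerMetric n M)
  {φ : OpenPartialHomeomorph M (Coord n)}

/-- The spray coefficients `γᵏ_{ab} yᵃ yᵇ` of the metric. -/
def spray (φ : OpenPartialHomeomorph M (Coord n)) (k : Fin n) (v : TM n M) : ℝ :=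
  ∑ a, ∑ b, F.formalChristoffel φ k a b v * fiberCoord φ v a * fiberCoord φ v b

theorem delta_metricN_gComp (k i j : Fin n) (v : TM n M) :
    delta φ (F.metricN φ) k (F.gComp φ i j) v =
      partialX φ k (F.gComp φ i j) v - 2 * ∑ m, F.metricN φ m k v * F.cartan φ i j m v := by
  simp only [delta, cartan, Finset.mul_sum]
  exact congrArg _ (Finset.sum_congr rfl fun m _ => by ring)

theorem chern_eq_formalChristoffel_sub (i j k : Fin n) (v : TM n M) :
    F.chern φ i j k v = F.formalChristoffel φ i j k v
      - ∑ l, F.gInv φ i l v * ((∑ m, F.metricN φ m k v * F.cartan φ l j m v)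
        + (∑ m, F.metricN φ m j v * F.cartan φ l k m v)
        - ∑ m, F.metricN φ m l v * F.cartan φ j k m v) := by
  simp only [chern, formalChristoffel, delta_metricN_gComp,
    Finset.mul_sum (s := Finset.univ) (a := (1 / 2 : ℝ))]
  rw [← Finset.sum_sub_distrib]
  exact Finset.sum_congr rfl fun l _ => by ring

variable (hφ : φ ∈ IsManifold.maximalAtlas 𝓘(ℝ, Coord n) ∞ M) {v : TM n M} (hv : v ∈ F.A)
  (hvφ : v.proj ∈ φ.source)
include hφ hv hvφ

theorem delta_gComp_symm (N : Fin n → Fin n → TM n M → ℝ) (k i j : Fin n) :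
    delta φ N k (F.gComp φ i j) v = delta φ N k (F.gComp φ j i) v :=
  delta_congr (F.localRep_gComp_symm hφ hv hvφ i j)

theorem chern_symm (i j k : Fin n) : F.chern φ i j k v = F.chern φ i k j v := by
  rw [chern, chern]
  refine congrArg _ (Finset.sum_congr rfl fun l _ => ?_)
  rw [F.delta_gComp_symm hφ hv hvφ _ l j k]
  ring

theorem sum_gComp_mul_chern (m j k : Fin n) :
    ∑ i, F.gComp φ m i v * F.chern φ i j k v =
      1 / 2 * (delta φ (F.metricN φ) k (F.gComp φ m j) v
        + delta φ (F.metricN φ) j (F.gComp φ m k) v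
        - delta φ (F.metricN φ) m (F.gComp φ j k) v) := by
  let b : Fin n → ℝ := fun l => 1 / 2 * (delta φ (F.metricN φ) k (F.gComp φ l j) v
    + delta φ (F.metricN φ) j (F.gComp φ l k) v - delta φ (F.metricN φ) l (F.gComp φ j k) v)
  have hchern : (fun i => F.chern φ i j k v) = (F.gMatrix φ v)⁻¹.mulVec b := by
    ext i
    simp only [chern, Finset.mul_sum]
    exact Finset.sum_congr rfl fun l _ => by simp only [gInv, b]; ring
  change (F.gMatrix φ v).mulVec (fun i => F.chern φ i j k v) m = b m
  rw [hchern, Matrix.mulVec_mulVec, Matrix.mul_nonsing_inv _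
    (isUnit_iff_ne_zero.mpr (F.det_gMatrix_ne_zero hφ hv hvφ)), Matrix.one_mulVec]

theorem delta_gComp_eq_sum_chern (k i j : Fin n) :
    delta φ (F.metricN φ) k (F.gComp φ i j) v =
      ∑ l, F.chern φ l k i v * F.gComp φ l j v + ∑ l, F.chern φ l k j v * F.gComp φ i l v := by
  have hleft : ∑ l, F.chern φ l k i v * F.gComp φ l j v =
      ∑ l, F.gComp φ j l v * F.chern φ l k i v :=
    Finset.sum_congr rfl fun l _ => by rw [F.gComp_symm hφ hv hvφ l j, mul_comm]
  have hright : ∑ l, F.chern φ l k j v * F.gComp φ i l v =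
      ∑ l, F.gComp φ i l v * F.chern φ l k j v :=
    Finset.sum_congr rfl fun l _ => mul_comm _ _
  rw [hleft, hright, F.sum_gComp_mul_chern hφ hv hvφ, F.sum_gComp_mul_chern hφ hv hvφ,
    F.delta_gComp_symm hφ hv hvφ _ k j i, F.delta_gComp_symm hφ hv hvφ _ j k i,
    F.delta_gComp_symm hφ hv hvφ _ i j k, F.delta_gComp_symm hφ hv hvφ _ j i k]
  ring

theorem sum_sum_mul_cartan_mul_fiberCoord (c : Fin n → ℝ) (i : Fin n) :
    ∑ k, (∑ m, c m * F.cartan φ i k m v) * fiberCoord φ v k = 0 := by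
  refine (Matrix.dotProduct_mulVec c (Matrix.of fun m k => F.cartan φ i k m v)
    (fiberCoord φ v)).symm.trans (Finset.sum_eq_zero fun m _ => mul_eq_zero_of_right _ ?_)
  exact F.sum_cartan_mul_fiberCoord hφ hv hvφ i m

theorem sum_metricN_mul_fiberCoord (m : Fin n) :
    ∑ k, F.metricN φ m k v * fiberCoord φ v k = F.spray φ m v := by
  have hcartan : ∑ k, (∑ q, (∑ l, F.gInv φ m l v * F.cartan φ l k q v) * F.spray φ q v) *
      fiberCoord φ v k = 0 :=
    calc _ = ∑ l, F.gInv φ m l v *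
          ∑ k, (∑ q, F.spray φ q v * F.cartan φ l k q v) * fiberCoord φ v k := by
          simp only [Finset.sum_mul, Finset.mul_sum]
          rw [Finset.sum_comm_cycle]
          exact Finset.sum_congr rfl fun l _ => Finset.sum_congr rfl fun k _ =>
            Finset.sum_congr rfl fun q _ => by ring
      _ = 0 := by simp only [F.sum_sum_mul_cartan_mul_fiberCoord hφ hv hvφ, mul_zero,
          Finset.sum_const_zero]
  calc ∑ k, F.metricN φ m k v * fiberCoord φ v k
      = ∑ k, (∑ l, F.formalChristoffel φ m k l v * fiberCoord φ v l) * fiberCoord φ v k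
        - ∑ k, (∑ q, (∑ l, F.gInv φ m l v * F.cartan φ l k q v) * F.spray φ q v) *
          fiberCoord φ v k := by
        rw [← Finset.sum_sub_distrib]
        exact Finset.sum_congr rfl fun k _ => sub_mul _ _ _
    _ = F.spray φ m v := by
        rw [hcartan, sub_zero, spray]
        simp only [Finset.sum_mul]
        exact Finset.sum_congr rfl fun k _ => Finset.sum_congr rfl fun l _ => by ring

theorem underlying_chern (i j : Fin n) :
    underlying φ (F.chern φ) i j v = F.metricN φ i j v := by
  have hcartan : ∀ l, ∑ k, ((∑ m, F.metricN φ m k v * F.cartan φ l j m v)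
        + (∑ m, F.metricN φ m j v * F.cartan φ l k m v)
        - ∑ m, F.metricN φ m l v * F.cartan φ j k m v) * fiberCoord φ v k =
      ∑ m, F.spray φ m v * F.cartan φ l j m v := fun l => by
    simp only [sub_mul, add_mul, Finset.sum_sub_distrib, Finset.sum_add_distrib,
      F.sum_sum_mul_cartan_mul_fiberCoord hφ hv hvφ, add_zero, sub_zero]
    simp only [← F.sum_metricN_mul_fiberCoord hφ hv hvφ, Finset.sum_mul]
    rw [Finset.sum_comm]
    exact Finset.sum_congr rfl fun m _ => Finset.sum_congr rfl fun k _ => by ring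
  have hchern : ∑ k, (∑ l, F.gInv φ i l v * ((∑ m, F.metricN φ m k v * F.cartan φ l j m v)
        + (∑ m, F.metricN φ m j v * F.cartan φ l k m v)
        - ∑ m, F.metricN φ m l v * F.cartan φ j k m v)) * fiberCoord φ v k =
      ∑ m, (∑ l, F.gInv φ i l v * F.cartan φ l j m v) * F.spray φ m v := by
    simp only [Finset.sum_mul _ _ (fiberCoord φ v _), mul_assoc]
    rw [Finset.sum_comm]
    simp only [← Finset.mul_sum, hcartan]
    simp only [Finset.sum_mul, Finset.mul_sum]
    rw [Finset.sum_comm]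
    exact Finset.sum_congr rfl fun m _ => Finset.sum_congr rfl fun k _ => by ring
  simp only [underlying, chern_eq_formalChristoffel_sub, sub_mul, Finset.sum_sub_distrib, hchern]
  rfl

theorem delta_underlying_chern (k : Fin n) (f : TM n M → ℝ) :
    delta φ (underlying φ (F.chern φ)) k f v = delta φ (F.metricN φ) k f v :=
  delta_congr_connection (F.underlying_chern hφ hv hvφ)

theorem delta_sqrt_abs_det (k : Fin n) :
    delta φ (F.metricN φ) k (fun w => √|(F.gMatrix φ w).det|) v =
      √|(F.gMatrix φ v).det| * ∑ i, F.chern φ i k i v := by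
  have hvv := ofCoord_coordOf hφ hvφ
  let G := F.gMatrix φ v
  have hdet : G.det ≠ 0 := F.det_gMatrix_ne_zero hφ hv hvφ
  have hg : ∀ i j, DifferentiableAt ℝ (localRep φ fun w => F.gMatrix φ w i j) (coordOf φ v) :=
    F.differentiableAt_gComp hφ hv hvφ
  let P : Matrix (Fin n) (Fin n) ℝ := .of fun l i => F.chern φ l k i v
  have hdelta : (Matrix.of fun i j => delta φ (F.metricN φ) k (fun w => F.gMatrix φ w i j) v) =
      P.transpose * G + G * P := by
    ext i j
    refine (F.delta_gComp_eq_sum_chern hφ hv hvφ k i j).trans (congrArg _ ?_)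
    exact Finset.sum_congr rfl fun l _ => mul_comm _ _
  have htrace : (G.adjugate * (P.transpose * G + G * P)).trace = 2 * G.det * P.trace := by
    rw [mul_add, Matrix.trace_add, ← mul_assoc, Matrix.trace_mul_cycle, ← mul_assoc,
      Matrix.mul_adjugate, Matrix.adjugate_mul, Matrix.smul_mul, Matrix.smul_mul, one_mul, one_mul,
      Matrix.trace_smul, Matrix.trace_smul, Matrix.trace_transpose, smul_eq_mul]
    ring
  rw [delta_comp (hasDerivAt_sqrt_abs hdet) (differentiableAt_localRep_det hg) hvv,
    delta_det hg hvv, hdelta, htrace]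
  change √|G.det| / (2 * G.det) * (2 * G.det * P.trace) = √|G.det| * P.trace
  field_simp

end ChernConnection

end PseudoFinslerMetric

section CovariantDerivative

variable {n : ℕ} {M : Type*} [TopologicalSpace M] [ChartedSpace (Coord n) M]
  [IsManifold 𝓘(ℝ, Coord n) ∞ M] {φ : OpenPartialHomeomorph M (Coord n)}
  (hφ : φ ∈ IsManifold.maximalAtlas 𝓘(ℝ, Coord n) ∞ M) {v : TM n M} (hvφ : v.proj ∈ φ.source)
  (Γ : Fin n → Fin n → Fin n → TM n M → ℝ) {N : Fin n → Fin n → TM n M → ℝ}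

/-- The components `∇ₖTⁱⱼ` of the covariant derivative of a `(1,1)`-tensor field. -/
def compNablaEnd (φ : OpenPartialHomeomorph M (Coord n)) (Γ : Fin n → Fin n → Fin n → TM n M → ℝ)
    (T : EndFieldA n M) (k i j : Fin n) (v : TM n M) : ℝ :=
  delta φ (underlying φ Γ) k (compEnd φ T i j) v + ∑ l, Γ i k l v * compEnd φ T l j v
    - ∑ l, Γ l k j v * compEnd φ T i l v

include hφ hvφ

theorem compEnd_nablaVec (X : VectorFieldA n M) (i k : Fin n) :
    compEnd φ (nablaVec φ Γ X) i k v =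
      delta φ (underlying φ Γ) k (compVec φ X i) v + ∑ l, Γ i k l v * compVec φ X l v := by
  simp [compEnd, nablaVec, PseudoFinslerMetric.dx_frame hφ hvφ]

theorem dx_nablaEnd (T : EndFieldA n M) (i : Fin n) (u w : Tan n v.proj) :
    dx φ v.proj i (nablaEnd φ Γ T v u w) =
      ∑ k, (∑ j, compNablaEnd φ Γ T k i j v * dx φ v.proj j w) * dx φ v.proj k u := by
  simp [nablaEnd, compNablaEnd, PseudoFinslerMetric.dx_frame hφ hvφ, Finset.sum_mul, mul_assoc,
    mul_comm (dx φ v.proj _ u)]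

theorem dx_apply_eq_sum_compEnd (T : EndFieldA n M) (i : Fin n) (w : Tan n v.proj) :
    dx φ v.proj i (T v w) = ∑ j, compEnd φ T i j v * dx φ v.proj j w := by
  conv_lhs => rw [PseudoFinslerMetric.sum_dx_frame hφ hvφ w]
  simp only [map_sum, map_smul, smul_eq_mul]
  exact Finset.sum_congr rfl fun j _ => mul_comm _ _

section Leibniz

variable {T : EndFieldA n M} {X : VectorFieldA n M}
  (hT : ∀ i j, DifferentiableAt ℝ (localRep φ (compEnd φ T i j)) (coordOf φ v))
  (hX : ∀ j, DifferentiableAt ℝ (localRep φ (compVec φ X j)) (coordOf φ v))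
include hT hX

theorem delta_compVec_apply (k i : Fin n) :
    delta φ N k (compVec φ (fun w => T w (X w)) i) v =
      ∑ j, (delta φ N k (compEnd φ T i j) v * compVec φ X j v
        + compEnd φ T i j v * delta φ N k (compVec φ X j) v) := by
  rw [← delta_sum_mul (hT i) hX (ofCoord_coordOf hφ hvφ)]
  exact delta_congr <| localRep_eventuallyEq hφ isOpen_univ
    (fun w _ hw => dx_apply_eq_sum_compEnd hφ hw T i (X w)) (Set.mem_univ v) hvφ

theorem compEnd_nablaVec_apply (i k : Fin n) :
    compEnd φ (nablaVec φ Γ fun w => T w (X w)) i k v =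
      ∑ j, compNablaEnd φ Γ T k i j v * compVec φ X j v
        + ∑ l, compEnd φ T i l v * compEnd φ (nablaVec φ Γ X) l k v := by
  have hTX : ∀ l, compVec φ (fun w => T w (X w)) l v = ∑ j, compEnd φ T l j v * compVec φ X j v :=
    fun l => dx_apply_eq_sum_compEnd hφ hvφ T l (X v)
  have hΓT : ∑ l, Γ i k l v * ∑ j, compEnd φ T l j v * compVec φ X j v =
      ∑ j, (∑ l, Γ i k l v * compEnd φ T l j v) * compVec φ X j v := by
    simp only [Finset.mul_sum, Finset.sum_mul, mul_assoc]
    exact Finset.sum_comm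
  have hΓX : ∑ l, compEnd φ T i l v * ∑ j, Γ l k j v * compVec φ X j v =
      ∑ j, (∑ l, Γ l k j v * compEnd φ T i l v) * compVec φ X j v := by
    simp only [Finset.mul_sum, Finset.sum_mul, mul_assoc, mul_left_comm (compEnd φ T i _ v)]
    exact Finset.sum_comm
  simp only [compEnd_nablaVec hφ hvφ, delta_compVec_apply hφ hvφ hT hX, hTX, compNablaEnd, add_mul,
    sub_mul, mul_add, Finset.sum_add_distrib, Finset.sum_sub_distrib, hΓT, hΓX]
  ring

theorem nablaVec_apply_apply (u : Tan n v.proj) :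
    nablaVec φ Γ (fun w => T w (X w)) v u =
      nablaEnd φ Γ T v u (X v) + T v (nablaVec φ Γ X v u) := by
  refine (frameBasis hφ hvφ).ext_elem fun i => ?_
  change dx φ v.proj i _ = dx φ v.proj i _
  rw [map_add, dx_nablaEnd hφ hvφ, dx_apply_eq_sum_compEnd hφ hvφ T,
    dx_apply_eq_sum_compEnd hφ hvφ (nablaVec φ Γ _)]
  simp only [dx_apply_eq_sum_compEnd hφ hvφ (nablaVec φ Γ X),
    compEnd_nablaVec_apply hφ hvφ Γ hT hX, add_mul, Finset.sum_add_distrib, Finset.mul_sum,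
    Finset.sum_mul, mul_assoc]
  exact congrArg _ Finset.sum_comm

end Leibniz

section Lie

variable {Γ} {s : ℕ}

theorem compCov_derivAction (S : CovFieldA n M s) (L : EndFieldA n M) (J : Fin s → Fin n) :
    compCov φ (fun w => derivAction (L w) (S w)) J v =
      ∑ a, ∑ k, compEnd φ L k (J a) v * compCov φ S (Function.update J a k) v := by
  refine (derivAction_apply _ _ _).trans (Finset.sum_congr rfl fun a _ => ?_)
  rw [PseudoFinslerMetric.sum_dx_frame hφ hvφ (L v _)]
  refine ((S v).toMultilinearMap.map_update_sum _ _ _ _).trans (Finset.sum_congr rfl fun k _ => ?_)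
  rw [ContinuousMultilinearMap.coe_coe, ContinuousMultilinearMap.map_update_smul, smul_eq_mul]
  refine congrArg _ (congrArg (S v) (funext fun b => ?_))
  obtain rfl | hb := eq_or_ne b a
  · simp
  · simp [hb]

theorem lieCov_eq_nablaCov_add_derivAction (X : VectorFieldA n M) (S : CovFieldA n M s)
    (hN : ∀ i j, underlying φ Γ i j v = N i j v) (hΓ : ∀ i j k, Γ i j k v = Γ i k j v) :
    lieCov φ N X S v = nablaCov φ Γ X S v + derivAction (nablaVec φ Γ X v) (S v) := by
  refine multilinear_ext_frame hφ hvφ fun J => ?_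
  refine (PseudoFinslerMetric.compCov_sum hφ (lieCov φ N X S) _ hvφ rfl J).trans ?_
  refine Eq.trans ?_ (congrArg₂ (· + ·)
    (PseudoFinslerMetric.compCov_sum hφ (nablaCov φ Γ X S) _ hvφ rfl J)
    (compCov_derivAction hφ hvφ S (nablaVec φ Γ X) J)).symm
  have htorsion : ∑ a, ∑ k, (∑ l, Γ k (J a) l v * compVec φ X l v) *
        compCov φ S (Function.update J a k) v =
      ∑ k, compVec φ X k v *
        ∑ a, ∑ l, Γ l k (J a) v * compCov φ S (Function.update J a l) v := by
    simp only [Finset.mul_sum, Finset.sum_mul]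
    rw [Finset.sum_comm_cycle]
    exact Finset.sum_congr rfl fun l _ => Finset.sum_congr rfl fun a _ =>
      Finset.sum_congr rfl fun k _ => by rw [hΓ k (J a) l]; ring
  simp only [compEnd_nablaVec hφ hvφ, delta_congr_connection hN, add_mul, mul_sub,
    Finset.sum_add_distrib, Finset.sum_sub_distrib, htorsion]
  ring

end Lie

end CovariantDerivative

namespace PseudoFinslerMetric

section Proposition

variable {n : ℕ} {M : Type*} [TopologicalSpace M] [ChartedSpace (Coord n) M]
  [IsManifold 𝓘(ℝ, Coord n) ∞ M] (F : PseudoFinslerMetric n M)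
  {φ : OpenPartialHomeomorph M (Coord n)}
  (hφ : φ ∈ IsManifold.maximalAtlas 𝓘(ℝ, Coord n) ∞ M) {v : TM n M} (hv : v ∈ F.A)
  (hvφ : v.proj ∈ φ.source) (X : VectorFieldA n M)

include hv in
theorem bilinForm_g_separatingLeft : (bilinForm (F.g v)).SeparatingLeft :=
  fun u hu => F.nondegenerate v hv u fun w => (bilinForm_apply _ u w).symm.trans (hu w)

include hφ hvφ in
theorem compCov_dVol (J : Fin n → Fin n) :
    compCov φ (F.dVol φ) J v = eps J * √|(F.gMatrix φ v).det| :=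
  (compCov_sum hφ _ _ hvφ (F.dVol_eq v) J).trans (mul_comm _ _)

include hφ hv hvφ

theorem lieCov_eq_nablaCov_add_derivAction_nabla {s : ℕ} (S : CovFieldA n M s) :
    lieCov φ (F.metricN φ) X S v =
      nablaCov φ (F.chern φ) X S v + derivAction (F.nabla φ X v) (S v) :=
  lieCov_eq_nablaCov_add_derivAction hφ hvφ X S (F.underlying_chern hφ hv hvφ)
    (F.chern_symm hφ hv hvφ)

theorem lieCov_eq_nablaCov_iff (S : CovFieldA n M 2) :
    lieCov φ (F.metricN φ) X S v = nablaCov φ (F.chern φ) X S v ↔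
      ∀ a b : Tan n v.proj, S v ![F.nabla φ X v a, b] = -S v ![a, F.nabla φ X v b] := by
  rw [F.lieCov_eq_nablaCov_add_derivAction_nabla hφ hv hvφ, add_eq_left]
  refine ⟨fun h a b => eq_neg_of_add_eq_zero_left ?_, fun h => ?_⟩
  · rw [← derivAction_two, h]
    rfl
  · ext w
    rw [← FinVec.etaExpand_eq w]
    change derivAction _ _ ![w 0, w 1] = 0
    rw [derivAction_two, h, neg_add_cancel]

theorem nablaCov_eq_zero {s : ℕ} {S : CovFieldA n M s}
    (h : ∀ J k, delta φ (F.metricN φ) k (compCov φ S J) v =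
      ∑ a, ∑ l, F.chern φ l k (J a) v * compCov φ S (Function.update J a l) v) :
    nablaCov φ (F.chern φ) X S v = 0 :=
  Finset.sum_eq_zero fun J _ => by
    simp only [F.delta_underlying_chern hφ hv hvφ, h, sub_self, mul_zero, Finset.sum_const_zero,
      zero_smul]

theorem nablaCov_g : nablaCov φ (F.chern φ) X F.g v = 0 := by
  refine F.nablaCov_eq_zero hφ hv hvφ X fun J k => ?_
  have hpair : ∀ J : Fin 2 → Fin n, compCov φ F.g J v = F.gComp φ (J 0) (J 1) v := fun J =>
    congrArg (compCov φ F.g · v) (FinVec.etaExpand_eq J).symm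
  have hJ : J = ![J 0, J 1] := (FinVec.etaExpand_eq J).symm
  have hJg : compCov φ F.g J = F.gComp φ (J 0) (J 1) := by
    rw [hJ]
    rfl
  simp [hJg, hpair, F.delta_gComp_eq_sum_chern hφ hv hvφ, Fin.sum_univ_two]

theorem nablaCov_dVol : nablaCov φ (F.chern φ) X (F.dVol φ) v = 0 := by
  refine F.nablaCov_eq_zero hφ hv hvφ X fun J k => ?_
  have htrace := sum_eps_update (fun j l => F.chern φ l k j v) J
  rw [delta_const_mul _ _ _ _ _ (fun w hw => F.compCov_dVol hφ hw J) hvφ,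
    F.delta_sqrt_abs_det hφ hv hvφ]
  simp only [F.compCov_dVol hφ hvφ, ← mul_assoc, ← Finset.sum_mul, htrace]
  ring

theorem divergence_eq_trace :
    F.divergence φ X v = LinearMap.trace ℝ (Tan n v.proj) (F.nabla φ X v).toLinearMap := by
  have hvol : √|(F.gMatrix φ v).det| ≠ 0 :=
    (Real.sqrt_pos.mpr (abs_pos.mpr (F.det_gMatrix_ne_zero hφ hv hvφ))).ne'
  have hlie : lieCov φ (F.metricN φ) X (F.dVol φ) v =
      derivAction (F.nabla φ X v) (F.dVol φ v) := by
    rw [F.lieCov_eq_nablaCov_add_derivAction_nabla hφ hv hvφ, F.nablaCov_dVol hφ hv hvφ, zero_add]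
  have heps : eps (id : Fin n → Fin n) = 1 := by simpa using eps_perm (1 : Equiv.Perm (Fin n))
  have hcomp : compCov φ (lieCov φ (F.metricN φ) X (F.dVol φ)) id v =
      (∑ a, compEnd φ (F.nabla φ X) a a v) * √|(F.gMatrix φ v).det| := by
    refine (congrArg (fun S => S fun a => frame φ v.proj (id a)) hlie).trans
      ((compCov_derivAction hφ hvφ (F.dVol φ) (F.nabla φ X) id).trans ?_)
    have htrace := sum_eps_update (fun j k => compEnd φ (F.nabla φ X) k j v) id
    simp only [F.compCov_dVol hφ hvφ, ← mul_assoc, ← Finset.sum_mul, htrace, heps, mul_one]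
  rw [divergence, hcomp, F.compCov_dVol hφ hvφ, heps, one_mul, mul_div_cancel_right₀ _ hvol,
    trace_eq_sum_dx hφ hvφ]
  rfl

theorem divergence_sub_trace {T : EndFieldA n M} (hT : SmoothEnd F.A T) {X : VectorFieldA n M}
    (hX : SmoothVec F.A X) :
    F.divergence φ (fun w => T w (X w)) v
        - LinearMap.trace ℝ (Tan n v.proj) (T v ∘L F.nabla φ X v).toLinearMap
      = contractDir (nablaEnd φ (F.chern φ) T v) (X v) := by
  have hTd := fun i j => differentiableAt_localRep hφ F.isOpen_A (hT φ hφ i j) hv hvφ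
  have hXd := fun j => differentiableAt_localRep hφ F.isOpen_A (hX φ hφ j) hv hvφ
  rw [F.divergence_eq_trace hφ hv hvφ, contractDir, ← map_sub]
  congr 1
  ext u
  exact sub_eq_of_eq_add (nablaVec_apply_apply hφ hvφ (F.chern φ) hTd hXd u)

theorem trace_comp_eq_zero_of_flat_skew {T : EndFieldA n M} {E : Tan n v.proj →L[ℝ] Tan n v.proj}
    (h : ∀ a b : Tan n v.proj, F.flat T v a (E b) = -F.flat T v b (E a)) :
    LinearMap.trace ℝ (Tan n v.proj) (T v ∘L E).toLinearMap = 0 := by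
  have : FiniteDimensional ℝ (Tan n v.proj) := (frameBasis hφ hvφ).finiteDimensional_of_finite
  refine trace_eq_zero_of_isSkewAdjoint (F.bilinForm_g_separatingLeft hv) fun a b => ?_
  calc bilinForm (F.g v) (T v (E a)) b
      = F.g v ![b, T v (E a)] := (bilinForm_apply _ _ _).trans (F.g_symm hφ hv hvφ _ _)
    _ = -F.g v ![a, T v (E b)] := h b a
    _ = bilinForm (F.g v) a (-T v (E b)) := by rw [map_neg, bilinForm_apply]

theorem trace_comp_nabla_eq_zero_of_flat_symm {T : EndFieldA n M}
    (hT : ∀ a b : Tan n v.proj, F.flat T v a b = F.flat T v b a)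
    (hX : lieCov φ (F.metricN φ) X F.g v = 0) :
    LinearMap.trace ℝ (Tan n v.proj) (T v ∘L F.nabla φ X v).toLinearMap = 0 := by
  have : FiniteDimensional ℝ (Tan n v.proj) := (frameBasis hφ hvφ).finiteDimensional_of_finite
  have hT_self : (bilinForm (F.g v)).IsSelfAdjoint (T v).toLinearMap := fun a b =>
    calc bilinForm (F.g v) (T v a) b
        = F.g v ![b, T v a] := (bilinForm_apply _ _ _).trans (F.g_symm hφ hv hvφ _ _)
      _ = F.g v ![a, T v b] := hT b a
      _ = bilinForm (F.g v) a (T v b) := (bilinForm_apply _ _ _).symm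
  rw [← F.nablaCov_g hφ hv hvφ X, F.lieCov_eq_nablaCov_iff hφ hv hvφ] at hX
  have hX_skew : (bilinForm (F.g v)).IsSkewAdjoint (F.nabla φ X v).toLinearMap := fun a b =>
    calc bilinForm (F.g v) (F.nabla φ X v a) b
        = -F.g v ![a, F.nabla φ X v b] := (bilinForm_apply _ _ _).trans (hX a b)
      _ = bilinForm (F.g v) a (-F.nabla φ X v b) := by rw [map_neg, bilinForm_apply]
  exact trace_mul_eq_zero_of_isSelfAdjoint_of_isSkewAdjoint
    (F.bilinForm_g_separatingLeft hv) hT_self hX_skew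

end Proposition

end PseudoFinslerMetric

end AnisotropicTensors

end

open AnisotropicTensors in
theorem mainTheorem6 {n : ℕ} {M : Type*} [TopologicalSpace M] [ChartedSpace (Coord n) M]
    [IsManifold 𝓘(ℝ, Coord n) ∞ M] (F : PseudoFinslerMetric n M)
    (S : CovFieldA n M 2) (hS : SmoothCov F.A S)
    (hSsymm : ∀ v ∈ F.A, ∀ a b : Tan n v.proj, S v ![a, b] = S v ![b, a])
    (T : EndFieldA n M) (hT : SmoothEnd F.A T)
    (X : VectorFieldA n M) (hX : SmoothVec F.A X)
    (φ : OpenPartialHomeomorph M (Coord n))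
    (hφ : φ ∈ IsManifold.maximalAtlas 𝓘(ℝ, Coord n) ∞ M)
    (v : TM n M) (hv : v ∈ F.A) (hvφ : v.proj ∈ φ.source) :
    -- part (A)
    List.TFAE [
      ∀ a b : Tan n v.proj, S v ![a, F.nabla φ X v b] = -S v ![b, F.nabla φ X v a],
      ∀ a b : Tan n v.proj, S v ![F.nabla φ X v a, b] = -S v ![a, F.nabla φ X v b],
      lieCov φ (F.metricN φ) X S v = nablaCov φ (F.chern φ) X S v] ∧
    -- part (B)
    F.divergence φ (fun w => T w (X w)) v
        - LinearMap.trace ℝ (Tan n v.proj) (T v ∘L F.nabla φ X v).toLinearMap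
      = contractDir (nablaEnd φ (F.chern φ) T v) (X v) ∧
    -- part (C)
    ((∀ a b : Tan n v.proj,
          F.flat T v a (F.nabla φ X v b) = -F.flat T v b (F.nabla φ X v a)) ∨
        ((∀ a b : Tan n v.proj, F.flat T v a b = F.flat T v b a) ∧
          lieCov φ (F.metricN φ) X F.g v = 0) →
      LinearMap.trace ℝ (Tan n v.proj) (T v ∘L F.nabla φ X v).toLinearMap = 0) := by
  refine ⟨?_, F.divergence_sub_trace hφ hv hvφ hT hX, ?_⟩
  · tfae_have 1 ↔ 2 := by
      refine ⟨fun h a b => ?_, fun h a b => ?_⟩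
      · rw [hSsymm v hv, h b a]
      · rw [hSsymm v hv b, h a b, neg_neg]
    tfae_have 3 ↔ 2 := F.lieCov_eq_nablaCov_iff hφ hv hvφ X S
    tfae_finish
  · rintro (hflat | ⟨hflat, hg⟩)
    · exact F.trace_comp_eq_zero_of_flat_skew hφ hv hvφ hflat
    · exact F.trace_comp_nabla_eq_zero_of_flat_symm hφ hv hvφ X hflat hg
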